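/- Let $\mathcal H=\{h_\nu\}_{\nu=1}^\infty$ be a family of convex functions $h_\nu:\mathbb R^n\to\mathbb R$ such that for each $\nu\in\mathbb N$: 1) $h_\nu(x)=h_\nu(|x_1|,\dots,|x_n|)$ for all $x\in\mathbb R^n$; 2) the restriction of $h_\nu$ to $[0,\infty)^n$ is nondecreasing in each variable; 3) $\lim_{x\to\infty} h_\nu(x)/\|x\|=+\infty$; 4) for each $M>0$ there is a constant $A_{\nu,M}>0$ such that $h_\nu(x)\le\sum_{1\le j\le n:\,x_j\ne0}x_j\ln\frac{x_j}{M}+A_{\nu,M}$ for all $x\in[0,\infty)^n$; 5) there is a constant $\gamma_\nu$ such that $h_\nu(x)-h_{\nu+1}(x)\ge\ln2\cdot\sum_{j=1}^nx_j-\gamma_\nu$ for all $x\in[0,\infty)^n$; 6) there is a constant $l_\nu$ such that $h_{\nu+1}(x+y)\le h_\nu(x)+h_\nu(y)+l_\nu$ for all $x,y\in[0,\infty)^n$. For $\nu\in\mathbb N$ let $G(h_\nu)$ be the space of all $f:\mathbb R^n\to\mathbb C$ that for every $m\in\mathbb Z_+$ belong to $C^m(\mathbb R^n)$ and satisfy $$\|f\|_{m,h_\nu}=\sup_{x\in\mathbb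 R^n,\ \beta\in\mathbb Z_+^n,\ |\alpha|\le m}\frac{|x^\beta(D^\alpha f)(x)|}{\beta!\,e^{-h_\nu(\beta)}}<\infty ,$$ with the topology defined by the norms $\|\cdot\|_{m,h_\nu}$ ($m\in\mathbb Z_+$), and let $\mathcal E(h_\nu)$ be the space of all $f\in C^\infty(\mathbb R^n)$ (complex-valued) that for every $m\in\mathbb Z_+$ satisfy $$\rho_{m,\nu}(f)=\sup_{x\in\mathbb R^n,\ \alpha\in\mathbb Z_+^n}\frac{(1+\|x\|)^m|(D^\alpha f)(x)|}{\alpha!\,e^{-h_\nu(\alpha)}}<\infty ,$$ with the topology defined by the norms $\rho_{m,\nu}$ ($m\in\mathbb Z_+$). Let $G(\mathcal H)=\bigcup_{\nu=1}^\infty G(h_\nu)$ and $\mathcal E(\mathcal H)=\bigcup_{\nu=1}^\infty\mathcal E(h_\nu)$, each with the (locally convex) inductive limit topology of the spaces of which it is the union. Then every $f\in G(\mathcal H)$ is integrable on $\mathbb R^n$, and the Fourier transformation $f\mapsto\hat f$, $$\hat f(x)=\frac1{(\sqrt{2\pi})^n}\int_{\mathbb R^n}f(\xi)e^{i\langle x,\xi\rangle}\,d\xi,\qquad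 x\in\mathbb R^n,$$ is an isomorphism of topological vector spaces from $G(\mathcal H)$ onto $\mathcal E(\mathcal H)$. -/

import Mathlib

open MeasureTheory Filter Set
open scoped ContDiff

/-- The Euclidean space `ℝⁿ`. -/
abbrev Rn (n : ℕ) : Type := EuclideanSpace ℝ (Fin n)

/-- A multi-index `α ∈ ℤ₊ⁿ`, seen as a point of `ℝⁿ`. -/
def multiPoint {n : ℕ} (α : Fin n → ℕ) : Rn n := WithLp.toLp 2 (fun i => (α i : ℝ))

/-- `|α| = α₁ + ⋯ + αₙ`. -/
def multiOrder {n : ℕ} (α : Fin n → ℕ) : ℕ := ∑ i, α i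

/-- `α! = α₁! ⋯ αₙ!`, as a real number. -/
noncomputable def multiFact {n : ℕ} (α : Fin n → ℕ) : ℝ := ∏ i, ((α i).factorial : ℝ)

/-- The partial derivative `∂f/∂xᵢ`. -/
noncomputable def partialDer {n : ℕ} (i : Fin n) (f : Rn n → ℂ) : Rn n → ℂ :=
  fun x => lineDeriv ℝ f x (EuclideanSpace.single i (1 : ℝ))

/-- `Dᵅ f = ∂₁^{α₁} (∂₂^{α₂} (⋯ (∂ₙ^{αₙ} f)))`. -/
noncomputable def multiDer {n : ℕ} (α : Fin n → ℕ) (f : Rn n → ℂ) : Rn n → ℂ :=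
  (List.finRange n).foldr (fun i g => (partialDer i)^[α i] g) f

/-- The standing conditions 1) - 6) on the family `h` of convex weight functions on `ℝⁿ`;
the sequence is indexed by `ν = 0, 1, 2, …`. -/
structure IsWeightFamily {n : ℕ} (h : ℕ → Rn n → ℝ) : Prop where
  convex : ∀ ν, ConvexOn ℝ univ (h ν)
  even : ∀ ν x, h ν x = h ν (WithLp.toLp 2 (fun i => |x i|))
  nondecreasing : ∀ ν, ∀ x y : Rn n, ∀ j, (∀ i, 0 ≤ x i) → (∀ i, i ≠ j → y i = x i) →
    x j ≤ y j → h ν x ≤ h ν y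
  superlinear : ∀ ν, Tendsto (fun x => h ν x / ‖x‖) (Bornology.cobounded (Rn n)) atTop
  upper : ∀ ν, ∀ M : ℝ, 0 < M → ∃ A : ℝ, 0 < A ∧ ∀ x : Rn n, (∀ i, 0 ≤ x i) →
    h ν x ≤ (∑ j with x j ≠ 0, x j * Real.log (x j / M)) + A
  step : ∀ ν, ∃ γ : ℝ, ∀ x : Rn n, (∀ i, 0 ≤ x i) →
    Real.log 2 * (∑ j, x j) - γ ≤ h ν x - h (ν + 1) x
  subadd : ∀ ν, ∃ l : ℝ, ∀ x y : Rn n, (∀ i, 0 ≤ x i) → (∀ i, 0 ≤ y i) →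
    h (ν + 1) (x + y) ≤ h ν x + h ν y + l

/-- The quotient `|x^β (Dᵅf)(x)| / (β! e^{-h(β)})`. -/
noncomputable def gTerm {n : ℕ} (h : Rn n → ℝ) (f : Rn n → ℂ) (x : Rn n)
    (β α : Fin n → ℕ) : ℝ :=
  ‖((∏ i, x i ^ β i : ℝ) : ℂ) * multiDer α f x‖ / (multiFact β * Real.exp (-h (multiPoint β)))

/-- The quotient `(1 + ‖x‖)^m |(Dᵅf)(x)| / (α! e^{-h(α)})`. -/
noncomputable def eTerm {n : ℕ} (h : Rn n → ℝ) (m : ℕ) (f : Rn n → ℂ) (x : Rn n)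
    (α : Fin n → ℕ) : ℝ :=
  (1 + ‖x‖) ^ m * ‖multiDer α f x‖ / (multiFact α * Real.exp (-h (multiPoint α)))

/-! ### Elementary facts used by the definitions -/

theorem multiFact_pos {n : ℕ} (α : Fin n → ℕ) : 0 < multiFact α :=
  Finset.prod_pos fun i _ => by exact_mod_cast (α i).factorial_pos

theorem partialDer_contDiff {n k : ℕ} (i : Fin n) {f : Rn n → ℂ}
    (hf : ContDiff ℝ ((k + 1 : ℕ) : WithTop ℕ∞) f) :
    ContDiff ℝ (k : WithTop ℕ∞) (partialDer i f) := by
  have hd : Differentiable ℝ f := hf.differentiable (by simp)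
  have e : partialDer i f = fun x => fderiv ℝ f x (EuclideanSpace.single i (1 : ℝ)) :=
    funext fun x => (hd x).lineDeriv_eq_fderiv
  rw [e]
  exact (hf.fderiv_right (m := (k : WithTop ℕ∞)) (by norm_cast)).clm_apply contDiff_const

theorem partialDer_add {n k : ℕ} (i : Fin n) {f g : Rn n → ℂ}
    (hf : ContDiff ℝ ((k + 1 : ℕ) : WithTop ℕ∞) f)
    (hg : ContDiff ℝ ((k + 1 : ℕ) : WithTop ℕ∞) g) :
    partialDer i (f + g) = partialDer i f + partialDer i g := by
  have hdf : Differentiable ℝ f := hf.differentiable (by simp)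
  have hdg : Differentiable ℝ g := hg.differentiable (by simp)
  funext x
  exact (((hdf x).hasFDerivAt.add (hdg x).hasFDerivAt).hasLineDerivAt _).lineDeriv.trans
    (congrArg₂ (· + ·) (hdf x).lineDeriv_eq_fderiv.symm (hdg x).lineDeriv_eq_fderiv.symm)

theorem partialDer_smul {n k : ℕ} (i : Fin n) (c : ℂ) {f : Rn n → ℂ}
    (hf : ContDiff ℝ ((k + 1 : ℕ) : WithTop ℕ∞) f) :
    partialDer i (c • f) = c • partialDer i f := by
  have hdf : Differentiable ℝ f := hf.differentiable (by simp)
  funext x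
  exact (((hdf x).hasFDerivAt.const_smul c).hasLineDerivAt _).lineDeriv.trans
      (congrArg (c • ·) (hdf x).lineDeriv_eq_fderiv.symm)

theorem partialDer_iterate {n : ℕ} (i : Fin n) (c : ℂ) (a : ℕ) : ∀ (k : ℕ) {f g : Rn n → ℂ},
    ContDiff ℝ ((k + a : ℕ) : WithTop ℕ∞) f → ContDiff ℝ ((k + a : ℕ) : WithTop ℕ∞) g →
    ContDiff ℝ (k : WithTop ℕ∞) ((partialDer i)^[a] f) ∧
    (partialDer i)^[a] (f + g) = (partialDer i)^[a] f + (partialDer i)^[a] g ∧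
    (partialDer i)^[a] (c • f) = c • (partialDer i)^[a] f := by
  induction a with
  | zero => intro k f g hf hg; exact ⟨by simpa using hf, rfl, rfl⟩
  | succ a ih =>
    intro k f g hf hg
    simp only [Function.iterate_succ_apply]
    rw [partialDer_add (k := k + a) i hf hg, partialDer_smul (k := k + a) i c hf]
    exact ih k (partialDer_contDiff i hf) (partialDer_contDiff i hg)

theorem multiDer_aux {n : ℕ} (α : Fin n → ℕ) (c : ℂ) (l : List (Fin n)) :
    ∀ (k : ℕ) {f g : Rn n → ℂ},
    ContDiff ℝ ((k + (l.map α).sum : ℕ) : WithTop ℕ∞) f →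
    ContDiff ℝ ((k + (l.map α).sum : ℕ) : WithTop ℕ∞) g →
    ContDiff ℝ (k : WithTop ℕ∞) (l.foldr (fun i g => (partialDer i)^[α i] g) f) ∧
    l.foldr (fun i g => (partialDer i)^[α i] g) (f + g) =
      l.foldr (fun i g => (partialDer i)^[α i] g) f +
      l.foldr (fun i g => (partialDer i)^[α i] g) g ∧
    l.foldr (fun i g => (partialDer i)^[α i] g) (c • f) =
      c • l.foldr (fun i g => (partialDer i)^[α i] g) f := by
  induction l with
  | nil => intro k f g hf hg; exact ⟨by simpa using hf, rfl, rfl⟩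
  | cons i l ih =>
    intro k f g hf hg
    simp only [List.map_cons, List.sum_cons, ← add_assoc] at hf hg
    obtain ⟨h1, h2, h3⟩ := ih (k + α i) hf hg
    obtain ⟨h1', -, -⟩ := ih (k + α i) hg hg
    simp only [List.foldr_cons]
    rw [h2, h3]
    exact partialDer_iterate i c (α i) k h1 h1'

theorem multiDer_linear {n m : ℕ} {α : Fin n → ℕ} (hα : multiOrder α ≤ m) (c : ℂ)
    {f g : Rn n → ℂ} (hf : ContDiff ℝ (m : WithTop ℕ∞) f) (hg : ContDiff ℝ (m : WithTop ℕ∞) g) :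
    multiDer α (f + g) = multiDer α f + multiDer α g ∧
    multiDer α (c • f) = c • multiDer α f := by
  have e : 0 + ((List.finRange n).map α).sum ≤ m := by
    rw [zero_add, ← List.ofFn_eq_map, List.sum_ofFn]; exact hα
  have e' : ((0 + ((List.finRange n).map α).sum : ℕ) : WithTop ℕ∞) ≤ (m : WithTop ℕ∞) := by
    exact_mod_cast e
  exact (multiDer_aux α c (List.finRange n) 0 (hf.of_le e') (hg.of_le e')).2

theorem gTerm_nonneg {n : ℕ} (h : Rn n → ℝ) (f : Rn n → ℂ) (x : Rn n) (β α : Fin n → ℕ) :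
    0 ≤ gTerm h f x β α := by
  have := multiFact_pos β
  unfold gTerm; positivity

theorem eTerm_nonneg {n : ℕ} (h : Rn n → ℝ) (m : ℕ) (f : Rn n → ℂ) (x : Rn n)
    (α : Fin n → ℕ) : 0 ≤ eTerm h m f x α := by
  have := multiFact_pos α
  unfold eTerm; positivity

theorem gTerm_add_le {n m : ℕ} (h : Rn n → ℝ) {f g : Rn n → ℂ}
    (hf : ContDiff ℝ (m : WithTop ℕ∞) f) (hg : ContDiff ℝ (m : WithTop ℕ∞) g) (x : Rn n)
    (β : Fin n → ℕ) {α : Fin n → ℕ} (hα : multiOrder α ≤ m) :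
    gTerm h (f + g) x β α ≤ gTerm h f x β α + gTerm h g x β α := by
  have := multiFact_pos β
  unfold gTerm
  rw [(multiDer_linear hα 0 hf hg).1, ← add_div, Pi.add_apply, mul_add]
  gcongr
  exact norm_add_le _ _

theorem gTerm_smul {n m : ℕ} (h : Rn n → ℝ) (c : ℂ) {f : Rn n → ℂ}
    (hf : ContDiff ℝ (m : WithTop ℕ∞) f) (x : Rn n)
    (β : Fin n → ℕ) {α : Fin n → ℕ} (hα : multiOrder α ≤ m) :
    gTerm h (c • f) x β α = ‖c‖ * gTerm h f x β α := by
  unfold gTerm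
  rw [(multiDer_linear hα c hf hf).2, Pi.smul_apply, smul_eq_mul, mul_left_comm, norm_mul c,
    mul_div_assoc]

theorem eTerm_add_le {n : ℕ} (h : Rn n → ℝ) (m : ℕ) {f g : Rn n → ℂ}
    (hf : ContDiff ℝ ∞ f) (hg : ContDiff ℝ ∞ g) (x : Rn n) (α : Fin n → ℕ) :
    eTerm h m (f + g) x α ≤ eTerm h m f x α + eTerm h m g x α := by
  have := multiFact_pos α
  unfold eTerm
  rw [(multiDer_linear le_rfl 0 (hf.of_le (by exact_mod_cast le_top))
    (hg.of_le (by exact_mod_cast le_top))).1, ← add_div, Pi.add_apply, ← mul_add]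
  gcongr
  exact norm_add_le _ _

theorem eTerm_smul {n : ℕ} (h : Rn n → ℝ) (m : ℕ) (c : ℂ) {f : Rn n → ℂ}
    (hf : ContDiff ℝ ∞ f) (x : Rn n) (α : Fin n → ℕ) :
    eTerm h m (c • f) x α = ‖c‖ * eTerm h m f x α := by
  have hf' := hf.of_le (m := (multiOrder α : WithTop ℕ∞)) (by exact_mod_cast le_top)
  unfold eTerm
  rw [(multiDer_linear le_rfl c hf' hf').2, Pi.smul_apply, smul_eq_mul, norm_mul,
    mul_left_comm, mul_div_assoc]

theorem bddAbove_range_sum_le {ι : Type} {u v w : ι → ℝ} (hu : BddAbove (range u))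
    (hv : BddAbove (range v)) (hw : ∀ i, w i ≤ u i + v i) : BddAbove (range w) := by
  obtain ⟨a, ha⟩ := hu
  obtain ⟨b, hb⟩ := hv
  exact ⟨a + b, by
    rintro _ ⟨i, rfl⟩
    exact (hw i).trans (add_le_add (ha ⟨i, rfl⟩) (hb ⟨i, rfl⟩))⟩

theorem bddAbove_range_const_mul {ι : Type} {u w : ι → ℝ} (hu : BddAbove (range u)) {c : ℝ}
    (hc : 0 ≤ c) (hw : ∀ i, w i ≤ c * u i) : BddAbove (range w) := by
  obtain ⟨a, ha⟩ := hu
  exact ⟨c * a, by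
    rintro _ ⟨i, rfl⟩
    exact (hw i).trans (mul_le_mul_of_nonneg_left (ha ⟨i, rfl⟩) hc)⟩

theorem iSup_add_le_of_bdd {ι : Type} [Nonempty ι] {u v w : ι → ℝ} (hu : BddAbove (range u))
    (hv : BddAbove (range v)) (hw : ∀ i, w i ≤ u i + v i) :
    ⨆ i, w i ≤ (⨆ i, u i) + ⨆ i, v i :=
  ciSup_le fun i => (hw i).trans (add_le_add (le_ciSup hu i) (le_ciSup hv i))

/-- The index set `{(x, β, α) : x ∈ ℝⁿ, β ∈ ℤ₊ⁿ, α ∈ ℤ₊ⁿ, |α| ≤ m}`. -/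
abbrev GIndex (n m : ℕ) : Type :=
  Rn n × (Fin n → ℕ) × {α : Fin n → ℕ // multiOrder α ≤ m}

instance (n m : ℕ) : Nonempty (GIndex n m) :=
  ⟨(0, 0, ⟨0, by simp [multiOrder]⟩)⟩

/-! ### The space `G(H)` -/

/-- `G_m(h)`: the functions `f ∈ C^m(ℝⁿ)` with `‖f‖_{m,h} < ∞`. -/
noncomputable def Gm {n : ℕ} (h : Rn n → ℝ) (m : ℕ) : Submodule ℂ (Rn n → ℂ) where
  carrier := {f | ContDiff ℝ (m : WithTop ℕ∞) f ∧
    BddAbove (range fun p : GIndex n m => gTerm h f p.1 p.2.1 p.2.2)}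
  add_mem' {f g} hf hg := ⟨hf.1.add hg.1,
    bddAbove_range_sum_le hf.2 hg.2 fun p => gTerm_add_le h hf.1 hg.1 _ _ p.2.2.2⟩
  zero_mem' := ⟨contDiff_const, 0, by
    rintro _ ⟨p, rfl⟩
    have := gTerm_smul h 0 (f := (0 : Rn n → ℂ)) (m := m) contDiff_const p.1 p.2.1 p.2.2.2
    simp only [zero_smul, norm_zero, zero_mul] at this
    exact this.le⟩
  smul_mem' c f hf := ⟨contDiff_const.smul hf.1,
    bddAbove_range_const_mul hf.2 (norm_nonneg c) fun p => (gTerm_smul h c hf.1 _ _ p.2.2.2).le⟩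

/-- The norm `‖f‖_{m,h} = sup |x^β (Dᵅf)(x)| / (β! e^{-h(β)})` over `x`, `β` and `|α| ≤ m`. -/
noncomputable def gNorm {n : ℕ} (h : Rn n → ℝ) (m : ℕ) : Seminorm ℂ (Gm h m) :=
  Seminorm.of (fun f => ⨆ p : GIndex n m, gTerm h f.1 p.1 p.2.1 p.2.2)
    (fun f g => iSup_add_le_of_bdd f.2.2 g.2.2
      fun p => gTerm_add_le h f.2.1 g.2.1 _ _ p.2.2.2)
    (fun c f => by
      rw [Real.mul_iSup_of_nonneg (norm_nonneg c)]
      exact iSup_congr fun p => gTerm_smul h c f.2.1 _ _ p.2.2.2)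

/-- `G(h) = ⋂ₘ G_m(h)`, as a set of functions. -/
noncomputable def GSub {n : ℕ} (h : Rn n → ℝ) : Submodule ℂ (Rn n → ℂ) := ⨅ m, Gm h m

/-- `G(h)` as a type, carrying the topology of the norms `‖·‖_{m,h}` below
(and not the topology of pointwise convergence). -/
def GSpace {n : ℕ} (h : Rn n → ℝ) : Type := ↥(GSub h)

noncomputable instance {n : ℕ} (h : Rn n → ℝ) : AddCommGroup (GSpace h) :=
  inferInstanceAs (AddCommGroup ↥(GSub h))

noncomputable instance {n : ℕ} (h : Rn n → ℝ) : Module ℂ (GSpace h) :=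
  inferInstanceAs (Module ℂ ↥(GSub h))

/-- The norm `‖·‖_{m,h}` on `G(h)`. -/
noncomputable def gSeminorm {n : ℕ} (h : Rn n → ℝ) : SeminormFamily ℂ (GSpace h) ℕ :=
  fun m => (gNorm h m).comp (Submodule.inclusion (iInf_le (Gm h) m) : ↥(GSub h) →ₗ[ℂ] Gm h m)

noncomputable instance {n : ℕ} (h : Rn n → ℝ) : TopologicalSpace (GSpace h) :=
  (gSeminorm h).moduleFilterBasis.topology

theorem IsWeightFamily.le_succ {n : ℕ} {h : ℕ → Rn n → ℝ} (hh : IsWeightFamily h) (ν : ℕ) :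
    ∃ γ : ℝ, ∀ α : Fin n → ℕ, h (ν + 1) (multiPoint α) ≤ h ν (multiPoint α) + γ := by
  obtain ⟨γ, hγ⟩ := hh.step ν
  refine ⟨γ, fun α => ?_⟩
  have h0 : ∀ i, 0 ≤ multiPoint α i := fun i => Nat.cast_nonneg (α i)
  have h1 := hγ (multiPoint α) h0
  have h2 : 0 ≤ Real.log 2 * ∑ j, multiPoint α j :=
    mul_nonneg (Real.log_nonneg (by norm_num)) (Finset.sum_nonneg fun i _ => h0 i)
  linarith

theorem weight_quot_le {a b u v γ : ℝ} (ha : 0 ≤ a) (hb : 0 < b) (huv : v ≤ u + γ) :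
    a / (b * Real.exp (-v)) ≤ Real.exp γ * (a / (b * Real.exp (-u))) := by
  have e : Real.exp γ * (a / (b * Real.exp (-u))) = a / (b * Real.exp (-(u + γ))) := by
    rw [neg_add, Real.exp_add, Real.exp_neg γ]
    have := Real.exp_pos γ
    field_simp
  rw [e]
  gcongr

theorem GSub_mono {n : ℕ} {h : ℕ → Rn n → ℝ} (hh : IsWeightFamily h) :
    Monotone fun ν => GSub (h ν) := by
  refine monotone_nat_of_le_succ fun ν => iInf_mono fun m f hf => ⟨hf.1, ?_⟩
  obtain ⟨γ, hγ⟩ := hh.le_succ ν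
  exact bddAbove_range_const_mul hf.2 (Real.exp_pos γ).le fun p =>
    weight_quot_le (norm_nonneg _) (multiFact_pos _) (hγ _)

/-- `G(H) = ⋃_ν G(h_ν)`, as a set of functions. -/
noncomputable def GUnion {n : ℕ} {h : ℕ → Rn n → ℝ} (hh : IsWeightFamily h) :
    Submodule ℂ (Rn n → ℂ) where
  carrier := ⋃ ν, (GSub (h ν) : Set (Rn n → ℂ))
  add_mem' {f g} hf hg := by
    obtain ⟨a, ha⟩ := mem_iUnion.1 hf
    obtain ⟨b, hb⟩ := mem_iUnion.1 hg
    exact mem_iUnion.2 ⟨max a b, add_mem (GSub_mono hh (le_max_left a b) ha)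
      (GSub_mono hh (le_max_right a b) hb)⟩
  zero_mem' := mem_iUnion.2 ⟨0, zero_mem _⟩
  smul_mem' c f hf := by
    obtain ⟨a, ha⟩ := mem_iUnion.1 hf
    exact mem_iUnion.2 ⟨a, Submodule.smul_mem _ c ha⟩

/-- The locally convex inductive limit topology on `V` with respect to maps `j i : W i → V`: the
finest locally convex vector space topology on `V` that makes every `j i` continuous. -/
@[reducible] def inductiveLimitTopology {ι : Type} {W : ι → Type} [∀ i, TopologicalSpace (W i)]
    {V : Type} [AddCommGroup V] [Module ℂ V] (j : ∀ i, W i → V) : TopologicalSpace V :=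
  sInf {t | (∀ i, @Continuous _ _ _ t (j i)) ∧ @IsTopologicalAddGroup V t _ ∧
    @ContinuousSMul ℂ V _ _ t ∧ @LocallyConvexSpace ℝ V _ _ _ _ t}

/-- `G(H)` as a type, carrying the inductive limit topology of the spaces `G(h_ν)`. -/
def GLimit {n : ℕ} {h : ℕ → Rn n → ℝ} (hh : IsWeightFamily h) : Type := ↥(GUnion hh)

noncomputable instance {n : ℕ} {h : ℕ → Rn n → ℝ} (hh : IsWeightFamily h) :
    AddCommGroup (GLimit hh) :=
  inferInstanceAs (AddCommGroup ↥(GUnion hh))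

noncomputable instance {n : ℕ} {h : ℕ → Rn n → ℝ} (hh : IsWeightFamily h) :
    Module ℂ (GLimit hh) :=
  inferInstanceAs (Module ℂ ↥(GUnion hh))

instance {n : ℕ} {h : ℕ → Rn n → ℝ} (hh : IsWeightFamily h) :
    CoeFun (GLimit hh) (fun _ => Rn n → ℂ) := ⟨fun f => f.1⟩

/-- The inclusion of `G(h_ν)` into `G(H)`. -/
noncomputable def gInclusion {n : ℕ} {h : ℕ → Rn n → ℝ} (hh : IsWeightFamily h) (ν : ℕ) :
    GSpace (h ν) → GLimit hh :=
  fun f => ⟨f.1, mem_iUnion.2 ⟨ν, f.2⟩⟩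

noncomputable instance {n : ℕ} {h : ℕ → Rn n → ℝ} (hh : IsWeightFamily h) :
    TopologicalSpace (GLimit hh) :=
  inductiveLimitTopology (gInclusion hh)

/-! ### The space `E(H)` -/

/-- `E_m(h)`: the functions `f ∈ C^∞(ℝⁿ)` with `ρ_m(f) < ∞`. -/
noncomputable def Em {n : ℕ} (h : Rn n → ℝ) (m : ℕ) : Submodule ℂ (Rn n → ℂ) where
  carrier := {f | ContDiff ℝ ∞ f ∧
    BddAbove (range fun p : Rn n × (Fin n → ℕ) => eTerm h m f p.1 p.2)}
  add_mem' {f g} hf hg := ⟨hf.1.add hg.1,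
    bddAbove_range_sum_le hf.2 hg.2 fun p => eTerm_add_le h m hf.1 hg.1 _ _⟩
  zero_mem' := ⟨contDiff_const, 0, by
    rintro _ ⟨p, rfl⟩
    have := eTerm_smul h m 0 (f := (0 : Rn n → ℂ)) contDiff_const p.1 p.2
    simp only [zero_smul, norm_zero, zero_mul] at this
    exact this.le⟩
  smul_mem' c f hf := ⟨contDiff_const.smul hf.1,
    bddAbove_range_const_mul hf.2 (norm_nonneg c) fun p => (eTerm_smul h m c hf.1 _ _).le⟩

/-- The norm `ρ_m(f) = sup (1 + ‖x‖)^m |(Dᵅf)(x)| / (α! e^{-h(α)})` over all `x` and `α`. -/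
noncomputable def eNorm {n : ℕ} (h : Rn n → ℝ) (m : ℕ) : Seminorm ℂ (Em h m) :=
  Seminorm.of (fun f => ⨆ p : Rn n × (Fin n → ℕ), eTerm h m f.1 p.1 p.2)
    (fun f g => iSup_add_le_of_bdd f.2.2 g.2.2 fun p => eTerm_add_le h m f.2.1 g.2.1 _ _)
    (fun c f => by
      rw [Real.mul_iSup_of_nonneg (norm_nonneg c)]
      exact iSup_congr fun p => eTerm_smul h m c f.2.1 _ _)

/-- `E(h) = ⋂ₘ E_m(h)`, as a set of functions. -/
noncomputable def ESub {n : ℕ} (h : Rn n → ℝ) : Submodule ℂ (Rn n → ℂ) := ⨅ m, Em h m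

/-- `E(h)` as a type, carrying the topology of the norms `ρ_m` below
(and not the topology of pointwise convergence). -/
def ESpace {n : ℕ} (h : Rn n → ℝ) : Type := ↥(ESub h)

noncomputable instance {n : ℕ} (h : Rn n → ℝ) : AddCommGroup (ESpace h) :=
  inferInstanceAs (AddCommGroup ↥(ESub h))

noncomputable instance {n : ℕ} (h : Rn n → ℝ) : Module ℂ (ESpace h) :=
  inferInstanceAs (Module ℂ ↥(ESub h))

/-- The norm `ρ_m` on `E(h)`. -/
noncomputable def eSeminorm {n : ℕ} (h : Rn n → ℝ) : SeminormFamily ℂ (ESpace h) ℕ :=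
  fun m => (eNorm h m).comp (Submodule.inclusion (iInf_le (Em h) m) : ↥(ESub h) →ₗ[ℂ] Em h m)

noncomputable instance {n : ℕ} (h : Rn n → ℝ) : TopologicalSpace (ESpace h) :=
  (eSeminorm h).moduleFilterBasis.topology

theorem ESub_mono {n : ℕ} {h : ℕ → Rn n → ℝ} (hh : IsWeightFamily h) :
    Monotone fun ν => ESub (h ν) := by
  refine monotone_nat_of_le_succ fun ν => iInf_mono fun m f hf => ⟨hf.1, ?_⟩
  obtain ⟨γ, hγ⟩ := hh.le_succ ν
  exact bddAbove_range_const_mul hf.2 (Real.exp_pos γ).le fun p =>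
    weight_quot_le (mul_nonneg (pow_nonneg (by positivity) _) (norm_nonneg _)) (multiFact_pos _) (hγ _)

/-- `E(H) = ⋃_ν E(h_ν)`, as a set of functions. -/
noncomputable def EUnion {n : ℕ} {h : ℕ → Rn n → ℝ} (hh : IsWeightFamily h) :
    Submodule ℂ (Rn n → ℂ) where
  carrier := ⋃ ν, (ESub (h ν) : Set (Rn n → ℂ))
  add_mem' {f g} hf hg := by
    obtain ⟨a, ha⟩ := mem_iUnion.1 hf
    obtain ⟨b, hb⟩ := mem_iUnion.1 hg
    exact mem_iUnion.2 ⟨max a b, add_mem (ESub_mono hh (le_max_left a b) ha)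
      (ESub_mono hh (le_max_right a b) hb)⟩
  zero_mem' := mem_iUnion.2 ⟨0, zero_mem _⟩
  smul_mem' c f hf := by
    obtain ⟨a, ha⟩ := mem_iUnion.1 hf
    exact mem_iUnion.2 ⟨a, Submodule.smul_mem _ c ha⟩

/-- `E(H)` as a type, carrying the inductive limit topology of the spaces `E(h_ν)`. -/
def ELimit {n : ℕ} {h : ℕ → Rn n → ℝ} (hh : IsWeightFamily h) : Type := ↥(EUnion hh)

noncomputable instance {n : ℕ} {h : ℕ → Rn n → ℝ} (hh : IsWeightFamily h) :
    AddCommGroup (ELimit hh) :=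
  inferInstanceAs (AddCommGroup ↥(EUnion hh))

noncomputable instance {n : ℕ} {h : ℕ → Rn n → ℝ} (hh : IsWeightFamily h) :
    Module ℂ (ELimit hh) :=
  inferInstanceAs (Module ℂ ↥(EUnion hh))

instance {n : ℕ} {h : ℕ → Rn n → ℝ} (hh : IsWeightFamily h) :
    CoeFun (ELimit hh) (fun _ => Rn n → ℂ) := ⟨fun f => f.1⟩

/-- The inclusion of `E(h_ν)` into `E(H)`. -/
noncomputable def eInclusion {n : ℕ} {h : ℕ → Rn n → ℝ} (hh : IsWeightFamily h) (ν : ℕ) :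
    ESpace (h ν) → ELimit hh :=
  fun f => ⟨f.1, mem_iUnion.2 ⟨ν, f.2⟩⟩

noncomputable instance {n : ℕ} {h : ℕ → Rn n → ℝ} (hh : IsWeightFamily h) :
    TopologicalSpace (ELimit hh) :=
  inductiveLimitTopology (eInclusion hh)

/-- The Fourier transform `(2π)^{-n/2} ∫ f(ξ) e^{i⟨x, ξ⟩} dξ`. -/
noncomputable def fourierTr {n : ℕ} (f : Rn n → ℂ) (x : Rn n) : ℂ :=
  1 / ((Real.sqrt (2 * Real.pi) : ℝ) : ℂ) ^ n *
    ∫ ξ : Rn n, f ξ * Complex.exp (Complex.I * ((inner ℝ x ξ : ℝ) : ℂ))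

/-!
Every function of `G(H)` or `E(H)` is a Schwartz function, and the Fourier transformation is a
bijection of the Schwartz space, so the theorem amounts to two estimates: the Fourier transformation
maps `G(h_ν)` continuously to `E(h_{ν+2})`, and its inverse maps `E(h_ν)` continuously to
`G(h_{ν+1})`. The universal property of the locally convex inductive limit does the rest.

Up to a unimodular constant, the Fourier transformation exchanges `x^β D^α` with `D^β x^α`.
Therefore

* for `f` in `G(h_ν)`, the function `D^β x^α f̂` is bounded by the integral of `|ξ^β D^α f|`. The
  polynomial weight that makes the integral converge raises one exponent of `ξ^β` by a constant,
  which costs a factor `C 2^{|β|}` because of the factorials; the condition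
  `IsWeightFamily.step` absorbs it by passing to `h_{ν+1}`
  (`IsWeightFamily.exists_one_add_norm_pow_mul_le`);
* for `g` in `E(h_ν)` with inverse transform `f`, the function `x^β D^α f` is bounded by the
  integral of `|D^β x^α g|`.

In both cases a boundedly large power of the coordinates has to be commuted past the derivative
`D^β`, for all `β` at once. By `[D^β, xᵢ] = βᵢ D^{β - eᵢ}` and `βᵢ (β - eᵢ)! ≤ β!` the lower-order
terms are governed by the weights `e^{-h(β - γ)}` with `γ` from a finite set, and monotonicity
and the condition `IsWeightFamily.subadd` bound these by multiples of the next weight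
`e^{-h_{ν+1}(β)}` (`IsWeightFamily.shiftDominated`). Since a single
step in the family has to pay for arbitrarily many commutations, the inductions in
`exists_norm_deriv_coord_le` and `exists_norm_coord_deriv_le` carry a general weight all of whose
shifts are dominated by a fixed one (`ShiftDominated`).
-/

/-! ### Monomials in commuting operators -/

/-- The monomial `a₁^{α₁} ⋯ aₙ^{αₙ}`, the factors being multiplied in this order. -/
def multiPow {n : ℕ} {R : Type*} [Monoid R] (a : Fin n → R) (α : Fin n → ℕ) : R :=
  ((List.finRange n).map fun i => a i ^ α i).prod

theorem multiIndex_induction {n : ℕ} {P : (Fin n → ℕ) → Prop} (zero : P 0)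
    (add_single : ∀ α i, P α → P (α + Pi.single i 1)) (α : Fin n → ℕ) : P α := by
  induction hk : multiOrder α generalizing α with
  | zero =>
    have : α = 0 := funext fun i => by
      simpa using (Finset.sum_eq_zero_iff.1 hk) i (Finset.mem_univ i)
    exact this ▸ zero
  | succ k ih =>
    obtain ⟨i, -, hi⟩ : ∃ i ∈ Finset.univ, α i ≠ 0 := by
      by_contra! hne
      rw [multiOrder, Finset.sum_eq_zero hne] at hk
      omega
    have e : α - Pi.single i 1 + Pi.single i 1 = α := by
      refine tsub_add_cancel_of_le fun j => ?_
      rcases eq_or_ne j i with rfl | hj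
      · simpa using Nat.one_le_iff_ne_zero.2 hi
      · simp [hj]
    rw [← e]
    refine add_single _ _ (ih _ ?_)
    rw [← e] at hk
    simp only [multiOrder, Pi.add_apply, Finset.sum_add_distrib, Finset.sum_pi_single',
      Finset.mem_univ, if_true] at hk
    simpa [multiOrder] using hk

section Monoid

variable {n : ℕ} {R : Type*} [Monoid R] (a : Fin n → R)

theorem multiPow_zero : multiPow a 0 = 1 := by
  simp [multiPow]

theorem multiPow_add_single (ha : ∀ i j, Commute (a i) (a j)) (α : Fin n → ℕ) (i : Fin n) :
    multiPow a (α + Pi.single i 1) = a i * multiPow a α := by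
  have key : ∀ l : List (Fin n), l.Nodup →
      (l.map fun j => a j ^ (α + Pi.single i 1 : Fin n → ℕ) j).prod =
        if i ∈ l then a i * (l.map fun j => a j ^ α j).prod
        else (l.map fun j => a j ^ α j).prod := by
    intro l
    induction l with
    | nil => simp
    | cons j l ih =>
      intro hl
      rw [List.nodup_cons] at hl
      simp only [List.map_cons, List.prod_cons, ih hl.2, List.mem_cons]
      rcases eq_or_ne i j with rfl | hij
      · simp [hl.1, pow_succ', mul_assoc]
      · by_cases hi : i ∈ l
        · simp [hij.symm, hij, hi, ← mul_assoc, ((ha i j).pow_right (α j)).eq]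
        · simp [hij.symm, hij, hi]
  simpa [multiPow] using key _ (List.nodup_finRange n)

theorem multiPow_commute (ha : ∀ i j, Commute (a i) (a j)) (α : Fin n → ℕ) (i : Fin n) :
    Commute (multiPow a α) (a i) :=
  Commute.list_prod_left _ _ fun b hb => by
    obtain ⟨j, -, rfl⟩ := List.mem_map.1 hb
    exact (ha j i).pow_left _

theorem multiPow_add_single_pow (ha : ∀ i j, Commute (a i) (a j)) (α : Fin n → ℕ) (i : Fin n)
    (k : ℕ) : multiPow a (α + Pi.single i k) = a i ^ k * multiPow a α := by
  induction k with
  | zero => simp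
  | succ k ih =>
    rw [Pi.single_add, ← add_assoc, multiPow_add_single a ha, ih, pow_succ', mul_assoc]

theorem multiPow_single (ha : ∀ i j, Commute (a i) (a j)) (i : Fin n) (k : ℕ) :
    multiPow a (Pi.single i k) = a i ^ k := by
  simpa [multiPow_zero] using multiPow_add_single_pow a ha 0 i k

end Monoid

/-- The Leibniz rule for a monomial in operators `d` that satisfy `[dⱼ, xᵢ] = δᵢⱼ`. -/
theorem multiPow_mul_coord {n : ℕ} {R : Type*} [Ring R] (d x : Fin n → R)
    (hd : ∀ i j, Commute (d i) (d j))
    (hdx : ∀ i j, d j * x i = x i * d j + if i = j then 1 else 0) (β : Fin n → ℕ) (i : Fin n) :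
    multiPow d β * x i = x i * multiPow d β + (β i : R) * multiPow d (β - Pi.single i 1) := by
  induction β using multiIndex_induction with
  | zero => simp [multiPow_zero]
  | add_single β j ih =>
    rw [multiPow_add_single d hd, mul_assoc, ih, mul_add, ← mul_assoc, hdx, add_mul, mul_assoc,
      add_assoc, ← mul_assoc (d j), ← (Nat.cast_commute (β i) (d j)).eq, mul_assoc,
      ← multiPow_add_single d hd, ← multiPow_add_single d hd]
    congr 1
    rcases eq_or_ne i j with rfl | hij
    · rcases Nat.eq_zero_or_pos (β i) with h0 | h0
      · simp [h0, add_tsub_cancel_right]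
      · have : β - Pi.single i 1 + Pi.single i 1 = β := by
          refine tsub_add_cancel_of_le fun j => ?_
          rcases eq_or_ne j i with rfl | hj
          · simpa using Nat.succ_le_of_lt h0
          · simp [hj]
        rw [this, add_tsub_cancel_right]
        simp [add_mul, add_comm]
    · have : β + Pi.single j 1 - Pi.single i 1 = β - Pi.single i 1 + Pi.single j 1 := by
        funext k
        rcases eq_or_ne k i with rfl | hk
        · simp [hij]
        · simp [hk]
      simp [hij, this]

/-- A linear map that intertwines `aᵢ` with `c bᵢ` intertwines the monomials accordingly. -/
theorem map_multiPow {n : ℕ} {V W : Type*} [AddCommGroup V] [Module ℂ V] [AddCommGroup W]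
    [Module ℂ W] (a : Fin n → Module.End ℂ V) (b : Fin n → Module.End ℂ W) (J : V →ₗ[ℂ] W) (c : ℂ)
    (hJ : ∀ i v, J (a i v) = c • b i (J v)) (α : Fin n → ℕ) (v : V) :
    J (multiPow a α v) = c ^ multiOrder α • multiPow b α (J v) := by
  have pow : ∀ i (k : ℕ) v, J ((a i ^ k) v) = c ^ k • (b i ^ k) (J v) := by
    intro i k
    induction k with
    | zero => simp
    | succ k ih =>
      intro v
      rw [pow_succ, Module.End.mul_apply, ih, hJ, map_smul, smul_smul, ← pow_succ, pow_succ (b i),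
        Module.End.mul_apply]
  have key : ∀ l : List (Fin n), J ((l.map fun i => a i ^ α i).prod v) =
      c ^ (l.map α).sum • (l.map fun i => b i ^ α i).prod (J v) := by
    intro l
    induction l with
    | nil => simp
    | cons i l ih =>
      simp only [List.map_cons, List.prod_cons, List.sum_cons, Module.End.mul_apply, pow, ih,
        map_smul, smul_smul, pow_add]
  rw [multiPow, key, multiOrder, ← List.sum_ofFn, List.ofFn_eq_map]
  rfl

/-! ### Differentiation and multiplication by coordinates on smooth functions -/

/-- The space `C^∞(ℝⁿ)` of complex-valued smooth functions. -/
def smoothFun (n : ℕ) : Submodule ℂ (Rn n → ℂ) where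
  carrier := {f | ContDiff ℝ ∞ f}
  add_mem' {f g} (hf : ContDiff ℝ ∞ f) (hg : ContDiff ℝ ∞ g) := hf.add hg
  zero_mem' := (contDiff_const : ContDiff ℝ ∞ fun _ : Rn n => (0 : ℂ))
  smul_mem' c f (hf : ContDiff ℝ ∞ f) := (contDiff_const (c := c)).smul hf

theorem smoothFun.contDiff {n : ℕ} (f : smoothFun n) : ContDiff ℝ ∞ (f : Rn n → ℂ) := f.2

theorem partialDer_eq_fderiv {n : ℕ} (i : Fin n) {f : Rn n → ℂ} (hf : ContDiff ℝ ∞ f) :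
    partialDer i f = fun x => fderiv ℝ f x (EuclideanSpace.single i (1 : ℝ)) :=
  funext fun x => (hf.differentiable (by simp) x).lineDeriv_eq_fderiv

theorem contDiff_partialDer {n : ℕ} (i : Fin n) {f : Rn n → ℂ} (hf : ContDiff ℝ ∞ f) :
    ContDiff ℝ ∞ (partialDer i f) := by
  rw [partialDer_eq_fderiv i hf]
  exact (hf.fderiv_right (m := ∞) (by simp)).clm_apply contDiff_const

/-- The operator `∂/∂xᵢ` on `C^∞(ℝⁿ)`. -/
noncomputable def derivOp {n : ℕ} (i : Fin n) : Module.End ℂ (smoothFun n) where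
  toFun f := ⟨partialDer i f, contDiff_partialDer i (smoothFun.contDiff f)⟩
  map_add' f g := Subtype.ext <| partialDer_add (k := 0) i
    ((smoothFun.contDiff f).of_le (by exact_mod_cast le_top))
    ((smoothFun.contDiff g).of_le (by exact_mod_cast le_top))
  map_smul' c f := Subtype.ext <| partialDer_smul (k := 0) i c
    ((smoothFun.contDiff f).of_le (by exact_mod_cast le_top))

theorem contDiff_coord {n : ℕ} (i : Fin n) : ContDiff ℝ ∞ fun x : Rn n => ((x i : ℝ) : ℂ) :=
  Complex.ofRealCLM.contDiff.comp (EuclideanSpace.proj (𝕜 := ℝ) i).contDiff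

/-- Multiplication by `xᵢ` on `C^∞(ℝⁿ)`. -/
noncomputable def coordOp {n : ℕ} (i : Fin n) : Module.End ℂ (smoothFun n) where
  toFun f := ⟨fun x => (x i : ℂ) * (f : Rn n → ℂ) x, (contDiff_coord i).mul (smoothFun.contDiff f)⟩
  map_add' f g := Subtype.ext <| funext fun x => by simp [mul_add]
  map_smul' c f := Subtype.ext <| funext fun x => by simp [mul_left_comm]

theorem coordOp_apply {n : ℕ} (i : Fin n) (f : smoothFun n) (x : Rn n) :
    (coordOp i f : Rn n → ℂ) x = (x i : ℂ) * (f : Rn n → ℂ) x := rfl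

theorem coordOp_pow_apply {n : ℕ} (i : Fin n) (k : ℕ) (f : smoothFun n) (x : Rn n) :
    ((coordOp i ^ k) f : Rn n → ℂ) x = (x i : ℂ) ^ k * (f : Rn n → ℂ) x := by
  induction k generalizing f with
  | zero => simp
  | succ k ih => rw [pow_succ, Module.End.mul_apply, ih, coordOp_apply, pow_succ, mul_assoc]

theorem derivOp_commute {n : ℕ} (i j : Fin n) : Commute (derivOp i) (derivOp j) := by
  refine LinearMap.ext fun f => Subtype.ext <| funext fun x => ?_
  have hd : Differentiable ℝ (fderiv ℝ (f : Rn n → ℂ)) :=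
    ((smoothFun.contDiff f).fderiv_right (m := ∞) (by simp)).differentiable (by simp)
  have e : ∀ i j, partialDer i (partialDer j f) x =
      fderiv ℝ (fderiv ℝ (f : Rn n → ℂ)) x (EuclideanSpace.single i (1 : ℝ))
        (EuclideanSpace.single j (1 : ℝ)) := by
    intro i j
    rw [partialDer_eq_fderiv i (contDiff_partialDer j (smoothFun.contDiff f)),
      partialDer_eq_fderiv j (smoothFun.contDiff f)]
    simp only
    rw [fderiv_clm_apply (hd x) (differentiableAt_const _)]
    simp
  change partialDer i (partialDer j f) x = partialDer j (partialDer i f) x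
  rw [e, e]
  exact ((smoothFun.contDiff f).contDiffAt.isSymmSndFDerivAt
    (by simpa using WithTop.coe_le_coe.2 (le_top : (2 : ℕ∞) ≤ ⊤))) _ _

theorem coordOp_commute {n : ℕ} (i j : Fin n) : Commute (coordOp i) (coordOp j) :=
  LinearMap.ext fun f => Subtype.ext <| funext fun x =>
    mul_left_comm (x i : ℂ) (x j : ℂ) ((f : Rn n → ℂ) x)

theorem derivOp_mul_coordOp {n : ℕ} (i j : Fin n) :
    derivOp j * coordOp i = coordOp i * derivOp j + if i = j then 1 else 0 := by
  refine LinearMap.ext fun f => Subtype.ext <| funext fun x => ?_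
  have hf : DifferentiableAt ℝ (f : Rn n → ℂ) x := (smoothFun.contDiff f).differentiable (by simp) x
  have hx : HasFDerivAt (fun x : Rn n => ((x i : ℝ) : ℂ))
      (Complex.ofRealCLM.comp (EuclideanSpace.proj (𝕜 := ℝ) i)) x :=
    (Complex.ofRealCLM.comp (EuclideanSpace.proj (𝕜 := ℝ) i)).hasFDerivAt
  have e : partialDer j (fun x => (x i : ℂ) * (f : Rn n → ℂ) x) x =
      (x i : ℂ) * partialDer j f x + if i = j then (f : Rn n → ℂ) x else 0 := by
    rw [partialDer_eq_fderiv j ((contDiff_coord i).mul (smoothFun.contDiff f)),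
      partialDer_eq_fderiv j (smoothFun.contDiff f)]
    simp only
    rw [(hx.fun_mul hf.hasFDerivAt).fderiv]
    by_cases hij : i = j <;> simp [hij]
  by_cases hij : i = j
  · simp only [hij, if_true] at e ⊢
    exact e
  · simp only [hij, if_false] at e ⊢
    rw [add_zero] at e ⊢
    exact e

theorem coe_multiPow_derivOp {n : ℕ} (α : Fin n → ℕ) (f : smoothFun n) :
    (multiPow derivOp α f : Rn n → ℂ) = multiDer α f := by
  have pow : ∀ i (k : ℕ) (g : smoothFun n),
      ((derivOp i ^ k) g : Rn n → ℂ) = (partialDer i)^[k] g := by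
    intro i k
    induction k with
    | zero => intro g; rfl
    | succ k ih => intro g; rw [pow_succ, Module.End.mul_apply, ih]; rfl
  unfold multiPow multiDer
  induction List.finRange n with
  | nil => rfl
  | cons i l ih => rw [List.map_cons, List.prod_cons, Module.End.mul_apply, pow, ih]; rfl

theorem multiPow_coordOp_apply {n : ℕ} (α : Fin n → ℕ) (f : smoothFun n) (x : Rn n) :
    (multiPow coordOp α f : Rn n → ℂ) x = ((∏ i, x i ^ α i : ℝ) : ℂ) * (f : Rn n → ℂ) x := by
  have key : ∀ l : List (Fin n), ((l.map fun i => coordOp i ^ α i).prod f : Rn n → ℂ) x =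
      (l.map fun i => (x i : ℂ) ^ α i).prod * (f : Rn n → ℂ) x := by
    intro l
    induction l with
    | nil => simp
    | cons i l ih =>
      rw [List.map_cons, List.prod_cons, Module.End.mul_apply, coordOp_pow_apply, ih, List.map_cons,
        List.prod_cons, mul_assoc]
  rw [multiPow, key, ← List.ofFn_eq_map, List.prod_ofFn]
  push_cast
  rfl

open SchwartzMap FourierTransform LineDeriv

/-! ### Rapidly decreasing functions and the Schwartz space -/

/-- All partial derivatives of `f` decrease faster than any power of `‖x‖`. -/
def RapidlyDecreasing {n : ℕ} (f : smoothFun n) : Prop :=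
  ∀ (α : Fin n → ℕ) (k : ℕ), ∃ C, ∀ x, ‖x‖ ^ k * ‖(multiPow derivOp α f : Rn n → ℂ) x‖ ≤ C

theorem RapidlyDecreasing.derivOp {n : ℕ} {f : smoothFun n} (hf : RapidlyDecreasing f)
    (i : Fin n) : RapidlyDecreasing (derivOp i f) := fun α k => by
  have e : multiPow _root_.derivOp α (_root_.derivOp i f) =
      multiPow _root_.derivOp (α + Pi.single i 1) f := by
    rw [multiPow_add_single _ derivOp_commute, ← (multiPow_commute _ derivOp_commute α i).eq]
    rfl
  rw [e]
  exact hf _ k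

/-- The total derivative, assembled from the partial derivatives. -/
theorem fderiv_eq_sum_partialDer {n : ℕ} (f : smoothFun n) :
    fderiv ℝ (f : Rn n → ℂ) = fun x => ∑ i : Fin n,
      (ContinuousLinearMap.smulRightL ℝ (Rn n) ℂ (EuclideanSpace.proj i) ∘
        (derivOp i f : Rn n → ℂ)) x := by
  funext x
  refine ContinuousLinearMap.ext fun v => ?_
  have hv : v = ∑ i, v i • EuclideanSpace.single i (1 : ℝ) := by
    ext j
    simp [Finset.sum_apply, Pi.single_apply]
  have e : ∀ i, (derivOp i f : Rn n → ℂ) x =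
      fderiv ℝ (f : Rn n → ℂ) x (EuclideanSpace.single i (1 : ℝ)) := fun i =>
    congrFun (partialDer_eq_fderiv i (smoothFun.contDiff f)) x
  conv_lhs => rw [hv, map_sum]
  simp [e]

theorem RapidlyDecreasing.iteratedFDeriv {n : ℕ} (m : ℕ) : ∀ {f : smoothFun n},
    RapidlyDecreasing f →
      ∀ k : ℕ, ∃ C, ∀ x, ‖x‖ ^ k * ‖iteratedFDeriv ℝ m (f : Rn n → ℂ) x‖ ≤ C := by
  induction m with
  | zero =>
    intro f hf k
    obtain ⟨C, hC⟩ := hf 0 k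
    refine ⟨C, fun x => ?_⟩
    simpa [multiPow_zero] using hC x
  | succ m ih =>
    intro f hf k
    choose C hC using fun i => ih (hf.derivOp i) k
    refine ⟨∑ i, ‖ContinuousLinearMap.smulRightL ℝ (Rn n) ℂ (EuclideanSpace.proj i)‖ * C i,
      fun x => ?_⟩
    have hc : ∀ i, ContDiff ℝ ∞ (_root_.derivOp i f : Rn n → ℂ) := fun i =>
      smoothFun.contDiff (_root_.derivOp i f)
    rw [← norm_iteratedFDeriv_fderiv, fderiv_eq_sum_partialDer,
      iteratedFDeriv_fun_sum_apply fun i _ => ((ContinuousLinearMap.contDiff _).comp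
        ((hc i).of_le (by exact_mod_cast le_top))).contDiffAt]
    calc _ ≤ ‖x‖ ^ k * ∑ i, ‖ContinuousLinearMap.smulRightL ℝ (Rn n) ℂ (EuclideanSpace.proj i)‖ *
          ‖_root_.iteratedFDeriv ℝ m (_root_.derivOp i f : Rn n → ℂ) x‖ := by
          gcongr
          refine norm_sum_le_of_le _ fun i _ => ?_
          exact ContinuousLinearMap.norm_iteratedFDeriv_comp_left _ (hc i).contDiffAt
            (by exact_mod_cast le_top)
      _ ≤ _ := by
          rw [Finset.mul_sum]
          refine Finset.sum_le_sum fun i _ => ?_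
          rw [mul_left_comm]
          gcongr
          exact hC i x

/-- A rapidly decreasing smooth function as an element of the Schwartz space. -/
def RapidlyDecreasing.toSchwartz {n : ℕ} {f : smoothFun n} (hf : RapidlyDecreasing f) :
    𝓢(Rn n, ℂ) where
  toFun := f
  smooth' := smoothFun.contDiff f
  decay' k m := hf.iteratedFDeriv m k

/-- The inclusion of the Schwartz space into `C^∞(ℝⁿ)`. -/
noncomputable def schwartzInclusion (n : ℕ) : 𝓢(Rn n, ℂ) →ₗ[ℂ] smoothFun n where
  toFun φ := ⟨φ, φ.smooth'⟩
  map_add' _ _ := rfl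
  map_smul' _ _ := rfl

/-- The operator `∂/∂xᵢ` on the Schwartz space. -/
noncomputable def schwartzDeriv {n : ℕ} (i : Fin n) : Module.End ℂ 𝓢(Rn n, ℂ) :=
  (lineDerivOpCLM ℂ 𝓢(Rn n, ℂ) (EuclideanSpace.single i (1 : ℝ))).toLinearMap

/-- Multiplication by `xᵢ` on the Schwartz space. -/
noncomputable def schwartzCoord {n : ℕ} (i : Fin n) : Module.End ℂ 𝓢(Rn n, ℂ) :=
  (smulLeftCLM ℂ fun x : Rn n => ((x i : ℝ) : ℂ)).toLinearMap

theorem schwartzCoord_apply {n : ℕ} (i : Fin n) (φ : 𝓢(Rn n, ℂ)) (x : Rn n) :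
    schwartzCoord i φ x = (x i : ℂ) * φ x :=
  smulLeftCLM_apply_apply
    (Complex.ofRealCLM.comp (EuclideanSpace.proj (𝕜 := ℝ) i)).hasTemperateGrowth φ x

theorem schwartzInclusion_deriv {n : ℕ} (i : Fin n) (φ : 𝓢(Rn n, ℂ)) :
    schwartzInclusion n (schwartzDeriv i φ) = (1 : ℂ) • derivOp i (schwartzInclusion n φ) := by
  rw [one_smul]
  exact Subtype.ext <| funext fun x => lineDerivOp_apply _ φ x

theorem schwartzInclusion_coord {n : ℕ} (i : Fin n) (φ : 𝓢(Rn n, ℂ)) :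
    schwartzInclusion n (schwartzCoord i φ) = (1 : ℂ) • coordOp i (schwartzInclusion n φ) := by
  rw [one_smul]
  exact Subtype.ext <| funext fun x => schwartzCoord_apply i φ x

theorem smulLeftCLM_inner_single {n : ℕ} (i : Fin n) (φ : 𝓢(Rn n, ℂ)) :
    smulLeftCLM ℂ (fun x : Rn n => (inner ℝ x (EuclideanSpace.single i (1 : ℝ)) : ℝ)) φ =
      schwartzCoord i φ := by
  ext x
  rw [schwartzCoord_apply, smulLeftCLM_apply_apply (by fun_prop), Complex.real_smul]
  simp [EuclideanSpace.inner_single_right]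

/-! ### The Fourier transformation of the Schwartz space -/

/-- The dilation `x ↦ x / 2π`. -/
noncomputable def twoPiScaling (n : ℕ) : Rn n ≃L[ℝ] Rn n :=
  ContinuousLinearEquiv.smulLeft (Units.mk0 (2 * Real.pi)⁻¹ (inv_ne_zero Real.two_pi_pos.ne'))

theorem twoPiScaling_apply {n : ℕ} (x : Rn n) : twoPiScaling n x = (2 * Real.pi)⁻¹ • x := rfl

/-- Composition of Schwartz functions with the dilation `x ↦ x / 2π`. -/
noncomputable def schwartzDilation (n : ℕ) : 𝓢(Rn n, ℂ) ≃ₗ[ℂ] 𝓢(Rn n, ℂ) where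
  __ := (compCLMOfContinuousLinearEquiv ℂ (twoPiScaling n)).toLinearMap
  invFun := compCLMOfContinuousLinearEquiv ℂ (twoPiScaling n).symm
  left_inv φ := by ext x; simp
  right_inv φ := by ext x; simp

/-- The normalizing factor `(2π)^{-n/2}`. -/
noncomputable def fourierConst (n : ℕ) : ℂ := 1 / ((Real.sqrt (2 * Real.pi) : ℝ) : ℂ) ^ n

theorem fourierConst_ne_zero (n : ℕ) : fourierConst n ≠ 0 := by
  have : Real.sqrt (2 * Real.pi) ≠ 0 := (Real.sqrt_pos.2 Real.two_pi_pos).ne'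
  exact div_ne_zero one_ne_zero (pow_ne_zero _ (Complex.ofReal_ne_zero.2 this))

/-- The Fourier transformation `φ ↦ (2π)^{-n/2} ∫ φ(ξ) e^{i⟨x, ξ⟩} dξ` of the Schwartz space: a
dilation and a multiple of Mathlib's inverse Fourier transform. -/
noncomputable def schwartzFourier (n : ℕ) : 𝓢(Rn n, ℂ) ≃ₗ[ℂ] 𝓢(Rn n, ℂ) :=
  (fourierEquiv ℂ 𝓢(Rn n, ℂ)).symm ≪≫ₗ schwartzDilation n ≪≫ₗ
    LinearEquiv.smulOfNeZero ℂ _ (fourierConst n) (fourierConst_ne_zero n)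

theorem schwartzFourier_eq {n : ℕ} (φ : 𝓢(Rn n, ℂ)) :
    schwartzFourier n φ = fourierConst n •
      compCLMOfContinuousLinearEquiv ℂ (twoPiScaling n) (𝓕⁻ φ) := rfl

theorem schwartzFourier_symm_eq {n : ℕ} (φ : 𝓢(Rn n, ℂ)) :
    (schwartzFourier n).symm φ = 𝓕 (compCLMOfContinuousLinearEquiv ℂ (twoPiScaling n).symm
      ((fourierConst n)⁻¹ • φ)) := rfl

theorem schwartzFourier_apply {n : ℕ} (φ : 𝓢(Rn n, ℂ)) (x : Rn n) :
    schwartzFourier n φ x = fourierTr φ x := by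
  rw [schwartzFourier_eq, fourierTr]
  change fourierConst n * (𝓕⁻ φ) (twoPiScaling n x) = _
  rw [fourierInv_coe, Real.fourierInv_eq', twoPiScaling_apply, fourierConst]
  congr 1
  refine integral_congr_ae (ae_of_all _ fun ξ => ?_)
  simp only [smul_eq_mul]
  rw [mul_comm, real_inner_smul_right, mul_inv_cancel_left₀ Real.two_pi_pos.ne',
    mul_comm _ Complex.I, real_inner_comm]

theorem schwartzFourier_coord {n : ℕ} (i : Fin n) (φ : 𝓢(Rn n, ℂ)) :
    schwartzFourier n (schwartzCoord i φ) =
      (-Complex.I) • schwartzDeriv i (schwartzFourier n φ) := by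
  have e : schwartzDeriv i (schwartzFourier n φ) = fourierConst n •
      compCLMOfContinuousLinearEquiv ℂ (twoPiScaling n)
        (∂_{twoPiScaling n (EuclideanSpace.single i (1 : ℝ))} (𝓕⁻ φ)) := by
    rw [schwartzFourier_eq, map_smul, ← lineDerivOp_compCLMOfContinuousLinearEquiv]
    rfl
  rw [e, twoPiScaling_apply, lineDerivOp_left_smul, lineDerivOp_fourierInv_eq,
    smulLeftCLM_inner_single, schwartzFourier_eq]
  ext x
  have hpi : (Real.pi : ℂ) ≠ 0 := by exact_mod_cast Real.pi_ne_zero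
  simp only [smul_apply, compCLMOfContinuousLinearEquiv_apply, Function.comp_apply, smul_eq_mul,
    fourierInv_smul, Complex.real_smul]
  push_cast
  field_simp
  simp

theorem schwartzFourier_deriv {n : ℕ} (i : Fin n) (φ : 𝓢(Rn n, ℂ)) :
    schwartzFourier n (schwartzDeriv i φ) =
      (-Complex.I) • schwartzCoord i (schwartzFourier n φ) := by
  rw [schwartzFourier_eq]
  change fourierConst n • compCLMOfContinuousLinearEquiv ℂ (twoPiScaling n)
    (𝓕⁻ (∂_{EuclideanSpace.single i (1 : ℝ)} φ)) = _
  rw [fourierInv_lineDerivOp_eq, smulLeftCLM_inner_single]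
  ext x
  have hpi : (Real.pi : ℂ) ≠ 0 := by exact_mod_cast Real.pi_ne_zero
  rw [smul_apply, smul_apply, schwartzCoord_apply, schwartzFourier_eq]
  simp only [smul_apply, compCLMOfContinuousLinearEquiv_apply, Function.comp_apply, smul_eq_mul,
    schwartzCoord_apply, twoPiScaling_apply, PiLp.smul_apply]
  push_cast
  field_simp

theorem schwartzFourier_symm_deriv {n : ℕ} (i : Fin n) (φ : 𝓢(Rn n, ℂ)) :
    (schwartzFourier n).symm (schwartzDeriv i φ) =
      Complex.I • schwartzCoord i ((schwartzFourier n).symm φ) := by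
  rw [LinearEquiv.symm_apply_eq, map_smul, schwartzFourier_coord, LinearEquiv.apply_symm_apply,
    smul_smul]
  simp

theorem schwartzFourier_symm_coord {n : ℕ} (i : Fin n) (φ : 𝓢(Rn n, ℂ)) :
    (schwartzFourier n).symm (schwartzCoord i φ) =
      Complex.I • schwartzDeriv i ((schwartzFourier n).symm φ) := by
  rw [LinearEquiv.symm_apply_eq, map_smul, schwartzFourier_deriv, LinearEquiv.apply_symm_apply,
    smul_smul]
  simp

/-- The Fourier transformation exchanges `x^β D^α` and `D^β x^α`, up to a unimodular constant. -/
theorem norm_multiPow_schwartzFourier {n : ℕ} (φ : 𝓢(Rn n, ℂ)) (α β : Fin n → ℕ) (x : Rn n) :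
    ‖(multiPow derivOp β (multiPow coordOp α (schwartzInclusion n (schwartzFourier n φ))) :
      Rn n → ℂ) x‖ =
      ‖schwartzFourier n (multiPow schwartzCoord β (multiPow schwartzDeriv α φ)) x‖ := by
  let J : 𝓢(Rn n, ℂ) →ₗ[ℂ] smoothFun n := schwartzInclusion n ∘ₗ (schwartzFourier n).toLinearMap
  have h1 : ∀ i ψ, J (schwartzCoord i ψ) = (-Complex.I) • derivOp i (J ψ) := fun i ψ => by
    simp only [J, LinearMap.comp_apply, LinearEquiv.coe_coe]
    rw [schwartzFourier_coord, map_smul, schwartzInclusion_deriv, one_smul]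
  have h2 : ∀ i ψ, J (schwartzDeriv i ψ) = (-Complex.I) • coordOp i (J ψ) := fun i ψ => by
    simp only [J, LinearMap.comp_apply, LinearEquiv.coe_coe]
    rw [schwartzFourier_deriv, map_smul, schwartzInclusion_coord, one_smul]
  change ‖(multiPow derivOp β (multiPow coordOp α (J φ)) : Rn n → ℂ) x‖ =
    ‖(J (multiPow schwartzCoord β (multiPow schwartzDeriv α φ)) : Rn n → ℂ) x‖
  rw [map_multiPow _ _ J _ h1, map_multiPow _ _ J _ h2]
  simp

/-- The inverse Fourier transformation exchanges `D^β x^α` and `x^β D^α`, up to a unimodular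
constant. -/
theorem norm_multiPow_schwartzFourier_symm {n : ℕ} (φ : 𝓢(Rn n, ℂ)) (α β : Fin n → ℕ) (x : Rn n) :
    ‖(multiPow coordOp β (multiPow derivOp α (schwartzInclusion n ((schwartzFourier n).symm φ))) :
      Rn n → ℂ) x‖ =
      ‖(schwartzFourier n).symm (multiPow schwartzDeriv β (multiPow schwartzCoord α φ)) x‖ := by
  let J : 𝓢(Rn n, ℂ) →ₗ[ℂ] smoothFun n :=
    schwartzInclusion n ∘ₗ (schwartzFourier n).symm.toLinearMap
  have h1 : ∀ i ψ, J (schwartzCoord i ψ) = Complex.I • derivOp i (J ψ) := fun i ψ => by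
    simp only [J, LinearMap.comp_apply, LinearEquiv.coe_coe]
    rw [schwartzFourier_symm_coord, map_smul, schwartzInclusion_deriv, one_smul]
  have h2 : ∀ i ψ, J (schwartzDeriv i ψ) = Complex.I • coordOp i (J ψ) := fun i ψ => by
    simp only [J, LinearMap.comp_apply, LinearEquiv.coe_coe]
    rw [schwartzFourier_symm_deriv, map_smul, schwartzInclusion_coord, one_smul]
  change ‖(multiPow coordOp β (multiPow derivOp α (J φ)) : Rn n → ℂ) x‖ =
    ‖(J (multiPow schwartzDeriv β (multiPow schwartzCoord α φ)) : Rn n → ℂ) x‖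
  rw [map_multiPow _ _ J _ h2, map_multiPow _ _ J _ h1]
  simp

/-- The Fourier transform and its inverse are bounded by a weighted supremum norm. -/
theorem exists_norm_schwartzFourier_le (n : ℕ) : ∃ (N : ℕ) (C : ℝ), 0 ≤ C ∧
    ∀ (φ : 𝓢(Rn n, ℂ)) (K : ℝ), (∀ x, (1 + ‖x‖) ^ N * ‖φ x‖ ≤ K) → ∀ x,
      ‖schwartzFourier n φ x‖ ≤ C * K ∧ ‖(schwartzFourier n).symm φ x‖ ≤ C * K := by
  let μ : Measure (Rn n) := volume
  let A : ℝ := 2 ^ μ.integrablePower * ∫ x, (1 + ‖x‖) ^ (-(μ.integrablePower : ℝ)) ∂μ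
  have hA : 0 ≤ A := by positivity
  have key : ∀ (g : Rn n → ℂ) (K : ℝ), (∀ x, (1 + ‖x‖) ^ μ.integrablePower * ‖g x‖ ≤ K) →
      ∫ x, ‖g x‖ ≤ A * (K + K) := by
    intro g K hK
    have h1 : ∀ x, ‖g x‖ ≤ K := fun x => le_trans
      (le_mul_of_one_le_left (norm_nonneg _) (one_le_pow₀ (by simp))) (hK x)
    have h2 : ∀ x, ‖x‖ ^ (0 + μ.integrablePower) * ‖g x‖ ≤ K := fun x => le_trans
      (by rw [zero_add]; gcongr; simp) (hK x)
    have h3 := integral_pow_mul_le_of_le_of_pow_mul_le (μ := μ) h1 h2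
    simp only [pow_zero, one_mul] at h3
    exact h3
  refine ⟨μ.integrablePower, (‖fourierConst n‖ + ‖(fourierConst n)⁻¹‖) * (A * 2), by positivity,
    fun φ K hK x => ⟨?_, ?_⟩⟩
  · have h0 : 0 ≤ K := le_trans (by positivity) (hK 0)
    rw [schwartzFourier_eq]
    change ‖fourierConst n * (𝓕⁻ φ) (twoPiScaling n x)‖ ≤ _
    rw [norm_mul, fourierInv_coe, Real.fourierInv_eq']
    calc _ ≤ ‖fourierConst n‖ * (A * (K + K)) := by
          gcongr
          refine (norm_integral_le_integral_norm _).trans (le_trans (le_of_eq ?_) (key φ K hK))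
          simp only [norm_smul, Complex.norm_exp_ofReal_mul_I, one_mul]
      _ = ‖fourierConst n‖ * (A * 2) * K := by ring
      _ ≤ _ := by gcongr; exact le_add_of_nonneg_right (norm_nonneg _)
  · have h0 : 0 ≤ K := le_trans (by positivity) (hK 0)
    rw [schwartzFourier_symm_eq, fourier_coe, Real.fourier_eq']
    have hg : ∀ x, (1 + ‖x‖) ^ μ.integrablePower *
        ‖(fourierConst n)⁻¹ * φ ((twoPiScaling n).symm x)‖ ≤ ‖(fourierConst n)⁻¹‖ * K := by
      intro x
      have hx : x = (2 * Real.pi)⁻¹ • (twoPiScaling n).symm x :=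
        ((twoPiScaling n).apply_symm_apply x).symm
      have hn : ‖x‖ ≤ ‖(twoPiScaling n).symm x‖ := by
        conv_lhs => rw [hx]
        rw [norm_smul]
        refine mul_le_of_le_one_left (norm_nonneg _) ?_
        rw [norm_inv, Real.norm_of_nonneg Real.two_pi_pos.le]
        exact inv_le_one_of_one_le₀ (by linarith [Real.pi_gt_three])
      rw [norm_mul, mul_left_comm]
      refine mul_le_mul_of_nonneg_left (le_trans ?_ (hK ((twoPiScaling n).symm x))) (norm_nonneg _)
      gcongr
    calc _ ≤ A * (‖(fourierConst n)⁻¹‖ * K + ‖(fourierConst n)⁻¹‖ * K) := by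
          refine (norm_integral_le_integral_norm _).trans (le_trans (le_of_eq ?_) (key _ _ hg))
          simp only [norm_smul, Complex.norm_exp_ofReal_mul_I, one_mul]
          rfl
      _ = ‖(fourierConst n)⁻¹‖ * (A * 2) * K := by ring
      _ ≤ _ := by gcongr; exact le_add_of_nonneg_left (norm_nonneg _)

/-! ### Weights on multi-indices -/

/-- Every shift `β ↦ W (β - γ)` of `W` (by truncated subtraction) is nonnegative and bounded by a
multiple of `W'`. This is the condition on weights under which the lower-order terms of the Leibniz
rule are harmless. -/
def ShiftDominated {n : ℕ} (W W' : (Fin n → ℕ) → ℝ) : Prop :=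
  ∀ γ, ∃ C, 0 ≤ C ∧ ∀ β, 0 ≤ W (β - γ) ∧ W (β - γ) ≤ C * W' β

theorem ShiftDominated.nonneg {n : ℕ} {W W' : (Fin n → ℕ) → ℝ} (hW : ShiftDominated W W')
    (β : Fin n → ℕ) : 0 ≤ W β := by
  obtain ⟨C, -, hC⟩ := hW 0
  simpa using (hC β).1

theorem ShiftDominated.add_shift {n : ℕ} {W W' : (Fin n → ℕ) → ℝ} (hW : ShiftDominated W W')
    (δ : Fin n → ℕ) : ShiftDominated (fun β => W β + W (β - δ)) W' := fun γ => by
  obtain ⟨C, hC0, hC⟩ := hW γ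
  obtain ⟨C', hC0', hC'⟩ := hW (γ + δ)
  refine ⟨C + C', by positivity, fun β => ?_⟩
  have h1 := hC β
  have h2 := hC' β
  simp only [tsub_tsub]
  exact ⟨add_nonneg h1.1 h2.1, by linarith⟩

theorem coord_mul_multiFact_sub_le {n : ℕ} (β : Fin n → ℕ) (i : Fin n) :
    (β i : ℝ) * multiFact (β - Pi.single i 1) ≤ multiFact β := by
  rcases Nat.eq_zero_or_pos (β i) with h0 | h0
  · rw [h0, Nat.cast_zero, zero_mul]
    exact (multiFact_pos β).le
  · rw [multiFact, multiFact, ← Finset.mul_prod_erase _ _ (Finset.mem_univ i),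
      ← Finset.mul_prod_erase _ (fun i => ((β i).factorial : ℝ)) (Finset.mem_univ i),
      ← mul_assoc]
    refine le_of_eq (congrArg₂ (· * ·) ?_ (Finset.prod_congr rfl fun j hj => ?_))
    · have := Nat.mul_factorial_pred h0.ne'
      simp only [Pi.sub_apply, Pi.single_eq_same]
      exact_mod_cast this
    · simp [(Finset.mem_erase.1 hj).1]

theorem multiFact_add_single_le {n : ℕ} (β : Fin n → ℕ) (i : Fin n) (N : ℕ) :
    multiFact (β + Pi.single i N) ≤ 2 ^ N * N.factorial * 2 ^ multiOrder β * multiFact β := by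
  have h1 : ((β i + N).factorial : ℝ) ≤ 2 ^ N * N.factorial * 2 ^ multiOrder β *
      (β i).factorial := by
    have h2 : β i + N ≤ multiOrder β + N :=
      Nat.add_le_add_right (Finset.single_le_sum (fun _ _ => Nat.zero_le _) (Finset.mem_univ i)) _
    have h3 : (β i + N).factorial ≤ 2 ^ (multiOrder β + N) * ((β i).factorial * N.factorial) := by
      rw [← Nat.add_choose_mul_factorial_mul_factorial, mul_assoc]
      exact Nat.mul_le_mul_right _
        ((Nat.choose_le_two_pow _ _).trans (Nat.pow_le_pow_right (by norm_num) h2))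
    calc ((β i + N).factorial : ℝ) ≤ ((2 ^ (multiOrder β + N) *
          ((β i).factorial * N.factorial) : ℕ) : ℝ) := by exact_mod_cast h3
      _ = _ := by push_cast; ring
  rw [multiFact, multiFact, ← Finset.mul_prod_erase _ _ (Finset.mem_univ i),
    ← Finset.mul_prod_erase _ (fun i => ((β i).factorial : ℝ)) (Finset.mem_univ i),
    ← mul_assoc]
  have h2 : ∏ j ∈ Finset.univ.erase i, (((β + Pi.single i N : Fin n → ℕ) j).factorial : ℝ) =
      ∏ j ∈ Finset.univ.erase i, ((β j).factorial : ℝ) :=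
    Finset.prod_congr rfl fun j hj => by simp [(Finset.mem_erase.1 hj).1]
  rw [h2]
  refine mul_le_mul_of_nonneg_right ?_ (Finset.prod_nonneg fun _ _ => by positivity)
  simpa using h1

/-- The weight `e^{-h(β)}` on multi-indices. -/
noncomputable def expWeight {n : ℕ} (h : Rn n → ℝ) (β : Fin n → ℕ) : ℝ :=
  Real.exp (-h (multiPoint β))

theorem expWeight_pos {n : ℕ} (h : Rn n → ℝ) (β : Fin n → ℕ) : 0 < expWeight h β :=
  Real.exp_pos _

theorem multiPoint_nonneg {n : ℕ} (β : Fin n → ℕ) (i : Fin n) : 0 ≤ multiPoint β i :=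
  Nat.cast_nonneg (β i)

theorem multiPoint_add {n : ℕ} (α β : Fin n → ℕ) :
    multiPoint (α + β) = multiPoint α + multiPoint β := by
  ext i
  simp [multiPoint]

namespace IsWeightFamily

variable {n : ℕ} {h : ℕ → Rn n → ℝ}

theorem multiPoint_mono (hh : IsWeightFamily h) (ν : ℕ) {α β : Fin n → ℕ} (hαβ : α ≤ β) :
    h ν (multiPoint α) ≤ h ν (multiPoint β) := by
  -- The coordinates are raised from `α` to `β` one at a time.
  have key : ∀ s : Finset (Fin n), h ν (multiPoint α) ≤ h ν (multiPoint (s.piecewise β α)) := by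
    intro s
    induction s using Finset.induction_on with
    | empty => simp
    | insert j s hj ih =>
      refine ih.trans (hh.nondecreasing ν _ _ j (multiPoint_nonneg _) (fun i hi => ?_) ?_)
      · simp [multiPoint, Finset.piecewise, hi]
      · simpa [multiPoint, Finset.piecewise, hj] using hαβ j
  simpa using key Finset.univ

theorem shiftDominated (hh : IsWeightFamily h) (ν : ℕ) :
    ShiftDominated (expWeight (h ν)) (expWeight (h (ν + 1))) := by
  intro γ
  obtain ⟨l, hl⟩ := hh.subadd ν
  refine ⟨Real.exp (h ν (multiPoint γ) + l), (Real.exp_pos _).le, fun β =>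
    ⟨(expWeight_pos _ _).le, ?_⟩⟩
  have h1 : h (ν + 1) (multiPoint β) ≤ h (ν + 1) (multiPoint (β - γ + γ)) :=
    hh.multiPoint_mono _ le_tsub_add
  rw [multiPoint_add] at h1
  have h2 := hl (multiPoint (β - γ)) (multiPoint γ) (multiPoint_nonneg _) (multiPoint_nonneg _)
  rw [expWeight, expWeight, ← Real.exp_add]
  exact Real.exp_le_exp.2 (by linarith)

theorem two_pow_mul_expWeight_le (hh : IsWeightFamily h) (ν : ℕ) : ∃ C, 0 ≤ C ∧ ∀ β : Fin n → ℕ,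
    2 ^ multiOrder β * expWeight (h ν) β ≤ C * expWeight (h (ν + 1)) β := by
  obtain ⟨γ, hγ⟩ := hh.step ν
  refine ⟨Real.exp γ, (Real.exp_pos _).le, fun β => ?_⟩
  have h1 := hγ (multiPoint β) (multiPoint_nonneg _)
  have h2 : ∑ j, multiPoint β j = (multiOrder β : ℝ) := by simp [multiPoint, multiOrder]
  have h3 : (2 : ℝ) ^ multiOrder β = Real.exp (Real.log 2 * multiOrder β) := by
    rw [mul_comm, Real.exp_nat_mul, Real.exp_log two_pos]
  rw [h2] at h1
  rw [expWeight, expWeight, h3, ← Real.exp_add, ← Real.exp_add]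
  exact Real.exp_le_exp.2 (by linarith)

/-- Raising one exponent by `N` costs a constant and one step in the family of weights. -/
theorem multiFact_mul_expWeight_add_single_le (hh : IsWeightFamily h) (ν N : ℕ) : ∃ C, 0 ≤ C ∧
    ∀ (β : Fin n → ℕ) (i : Fin n),
      multiFact (β + Pi.single i N) * expWeight (h ν) (β + Pi.single i N) ≤
        C * (multiFact β * expWeight (h (ν + 1)) β) := by
  obtain ⟨C, hC0, hC⟩ := hh.two_pow_mul_expWeight_le ν
  refine ⟨2 ^ N * N.factorial * C, by positivity, fun β i => ?_⟩
  have h1 : expWeight (h ν) (β + Pi.single i N) ≤ expWeight (h ν) β :=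
    Real.exp_le_exp.2 (neg_le_neg (hh.multiPoint_mono ν le_self_add))
  calc _ ≤ (2 ^ N * N.factorial * 2 ^ multiOrder β * multiFact β) * expWeight (h ν) β :=
        mul_le_mul (multiFact_add_single_le β i N) h1 (expWeight_pos _ _).le
          (mul_nonneg (by positivity) (multiFact_pos β).le)
    _ = (2 ^ N * N.factorial * multiFact β) * (2 ^ multiOrder β * expWeight (h ν) β) := by ring
    _ ≤ (2 ^ N * N.factorial * multiFact β) * (C * expWeight (h (ν + 1)) β) :=
        mul_le_mul_of_nonneg_left (hC β) (mul_nonneg (by positivity) (multiFact_pos β).le)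
    _ = _ := by ring

end IsWeightFamily

/-! ### Commuting derivatives past coordinates in weighted estimates -/

theorem multiPow_derivOp_coordOp {n : ℕ} (β : Fin n → ℕ) (i : Fin n) (f : smoothFun n) (x : Rn n) :
    (multiPow derivOp β (coordOp i f) : Rn n → ℂ) x =
      (x i : ℂ) * (multiPow derivOp β f : Rn n → ℂ) x +
        (β i : ℂ) * (multiPow derivOp (β - Pi.single i 1) f : Rn n → ℂ) x := by
  have e := congrFun (congrArg (Subtype.val) (LinearMap.congr_fun
    (multiPow_mul_coord derivOp coordOp derivOp_commute derivOp_mul_coordOp β i) f)) x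
  rw [Module.End.mul_apply] at e
  rw [e]
  simp only [LinearMap.add_apply, Module.End.mul_apply, Module.End.natCast_apply, Submodule.coe_add,
    Pi.add_apply, coordOp_apply]
  congr 1
  rw [← Nat.cast_smul_eq_nsmul ℂ]
  rfl

theorem norm_coord_le {n : ℕ} (x : Rn n) (i : Fin n) : ‖(x i : ℂ)‖ ≤ 1 + ‖x‖ := by
  rw [Complex.norm_real]
  exact (PiLp.norm_apply_le x i).trans (by simp)

/-- Weighted bounds for the derivatives of `g` give weighted bounds for those of `x^α g`. -/
theorem exists_norm_deriv_coord_le {n : ℕ} (W' : (Fin n → ℕ) → ℝ) (α : Fin n → ℕ) :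
    ∀ W, ShiftDominated W W' → ∃ C, 0 ≤ C ∧ ∀ (N : ℕ) (g : smoothFun n) (K : ℝ), 0 ≤ K →
      (∀ β x, (1 + ‖x‖) ^ (N + multiOrder α) * ‖(multiPow derivOp β g : Rn n → ℂ) x‖ ≤
        K * (multiFact β * W β)) →
      ∀ β x, (1 + ‖x‖) ^ N * ‖(multiPow derivOp β (multiPow coordOp α g) : Rn n → ℂ) x‖ ≤
        C * K * (multiFact β * W' β) := by
  induction α using multiIndex_induction with
  | zero =>
    intro W hW
    obtain ⟨C, hC0, hC⟩ := hW 0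
    refine ⟨C, hC0, fun N g K hK hg β x => ?_⟩
    have h1 := hg β x
    simp only [multiOrder, Pi.zero_apply, Finset.sum_const_zero, add_zero] at h1
    rw [multiPow_zero, Module.End.one_apply]
    calc _ ≤ K * (multiFact β * W β) := h1
      _ ≤ K * (multiFact β * (C * W' β)) := by
          have := (hC β).2
          rw [tsub_zero] at this
          have := (multiFact_pos β).le
          gcongr
      _ = _ := by ring
  | add_single α i ih =>
    intro W hW
    obtain ⟨C, hC0, hC⟩ := ih _ (hW.add_shift (Pi.single i 1))
    refine ⟨C, hC0, fun N g K hK hg β x => ?_⟩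
    rw [multiPow_add_single _ coordOp_commute, ← (multiPow_commute _ coordOp_commute α i).eq,
      Module.End.mul_apply]
    refine hC N (coordOp i g) K hK (fun β x => ?_) β x
    have e : N + multiOrder (α + Pi.single i 1) = N + multiOrder α + 1 := by
      simp [multiOrder, Finset.sum_add_distrib, add_assoc]
    rw [e] at hg
    rw [multiPow_derivOp_coordOp]
    have h1 := hg β x
    have h2 := hg (β - Pi.single i 1) x
    have h3 : (1 + ‖x‖) ^ (N + multiOrder α) *
        ‖(multiPow derivOp (β - Pi.single i 1) g : Rn n → ℂ) x‖ ≤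
        K * (multiFact (β - Pi.single i 1) * W (β - Pi.single i 1)) :=
      le_trans (mul_le_mul_of_nonneg_right (pow_le_pow_right₀ (by simp) (Nat.le_succ _))
        (norm_nonneg _)) h2
    calc _ ≤ (1 + ‖x‖) ^ (N + multiOrder α) * ((1 + ‖x‖) * ‖(multiPow derivOp β g : Rn n → ℂ) x‖ +
          (β i : ℝ) * ‖(multiPow derivOp (β - Pi.single i 1) g : Rn n → ℂ) x‖) := by
          gcongr
          refine (norm_add_le _ _).trans ?_
          rw [norm_mul, norm_mul, Complex.norm_natCast]
          gcongr
          exact norm_coord_le x i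
      _ = (1 + ‖x‖) ^ (N + multiOrder α + 1) * ‖(multiPow derivOp β g : Rn n → ℂ) x‖ +
          (β i : ℝ) * ((1 + ‖x‖) ^ (N + multiOrder α) *
            ‖(multiPow derivOp (β - Pi.single i 1) g : Rn n → ℂ) x‖) := by ring
      _ ≤ K * (multiFact β * W β) +
          (β i : ℝ) * (K * (multiFact (β - Pi.single i 1) * W (β - Pi.single i 1))) := by gcongr
      _ = K * (multiFact β * W β) +
          K * (((β i : ℝ) * multiFact (β - Pi.single i 1)) * W (β - Pi.single i 1)) := by ring
      _ ≤ K * (multiFact β * W β) + K * (multiFact β * W (β - Pi.single i 1)) := by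
          have := hW.nonneg (β - Pi.single i 1)
          have := coord_mul_multiFact_sub_le β i
          gcongr
      _ = _ := by ring

/-- Weighted bounds for the derivatives of `xᵢ^j u`, `j ≤ k`, give weighted bounds for `xᵢ^k` times
the derivatives of `u`. -/
theorem exists_norm_coord_deriv_le {n : ℕ} (W W' : (Fin n → ℕ) → ℝ) (hW : ShiftDominated W W')
    (i : Fin n) (k : ℕ) : ∃ V, ShiftDominated V W' ∧ ∀ (u : smoothFun n) (K : ℝ), 0 ≤ K →
      (∀ j ≤ k, ∀ β x, ‖(multiPow derivOp β ((coordOp i ^ j) u) : Rn n → ℂ) x‖ ≤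
        K * (multiFact β * W β)) →
      ∀ β x, |x i| ^ k * ‖(multiPow derivOp β u : Rn n → ℂ) x‖ ≤ K * (multiFact β * V β) := by
  induction k with
  | zero =>
    refine ⟨W, hW, fun u K hK hu β x => ?_⟩
    simpa using hu 0 le_rfl β x
  | succ k ih =>
    obtain ⟨V, hV, h⟩ := ih
    refine ⟨_, hV.add_shift (Pi.single i 1), fun u K hK hu β x => ?_⟩
    have h1 := h (coordOp i u) K hK (fun j hj β x => by
      have := hu (j + 1) (by omega) β x
      rwa [pow_succ, Module.End.mul_apply] at this) β x
    have h2 := h u K hK (fun j hj => hu j (by omega)) (β - Pi.single i 1) x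
    rw [multiPow_derivOp_coordOp] at h1
    have h3 : |x i| * ‖(multiPow derivOp β u : Rn n → ℂ) x‖ ≤
        ‖(x i : ℂ) * (multiPow derivOp β u : Rn n → ℂ) x +
          (β i : ℂ) * (multiPow derivOp (β - Pi.single i 1) u : Rn n → ℂ) x‖ +
        (β i : ℝ) * ‖(multiPow derivOp (β - Pi.single i 1) u : Rn n → ℂ) x‖ := by
      have e := norm_add_le ((x i : ℂ) * (multiPow derivOp β u : Rn n → ℂ) x +
          (β i : ℂ) * (multiPow derivOp (β - Pi.single i 1) u : Rn n → ℂ) x)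
        (-((β i : ℂ) * (multiPow derivOp (β - Pi.single i 1) u : Rn n → ℂ) x))
      rw [add_neg_cancel_right, norm_neg, norm_mul, norm_mul (β i : ℂ), Complex.norm_natCast,
        Complex.norm_real, Real.norm_eq_abs] at e
      exact e
    calc _ = |x i| ^ k * (|x i| * ‖(multiPow derivOp β u : Rn n → ℂ) x‖) := by ring
      _ ≤ |x i| ^ k * (‖(x i : ℂ) * (multiPow derivOp β u : Rn n → ℂ) x +
          (β i : ℂ) * (multiPow derivOp (β - Pi.single i 1) u : Rn n → ℂ) x‖ +
          (β i : ℝ) * ‖(multiPow derivOp (β - Pi.single i 1) u : Rn n → ℂ) x‖) := by gcongr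
      _ = |x i| ^ k * ‖(x i : ℂ) * (multiPow derivOp β u : Rn n → ℂ) x +
          (β i : ℂ) * (multiPow derivOp (β - Pi.single i 1) u : Rn n → ℂ) x‖ +
          (β i : ℝ) * (|x i| ^ k * ‖(multiPow derivOp (β - Pi.single i 1) u : Rn n → ℂ) x‖) := by
          ring
      _ ≤ K * (multiFact β * V β) +
          (β i : ℝ) * (K * (multiFact (β - Pi.single i 1) * V (β - Pi.single i 1))) := by gcongr
      _ = K * (multiFact β * V β) +
          K * (((β i : ℝ) * multiFact (β - Pi.single i 1)) * V (β - Pi.single i 1)) := by ring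
      _ ≤ K * (multiFact β * V β) + K * (multiFact β * V (β - Pi.single i 1)) := by
          have := hV.nonneg (β - Pi.single i 1)
          have := coord_mul_multiFact_sub_le β i
          gcongr
      _ = _ := by ring

/-- Polynomial weights are controlled by powers of the coordinates. -/
theorem one_add_norm_pow_le {n : ℕ} (N : ℕ) (x : Rn n) :
    (1 + ‖x‖) ^ N ≤ ((n : ℝ) + 1) ^ N * (1 + ∑ i, |x i| ^ N) := by
  have hx : ‖x‖ ≤ ∑ i, |x i| := by
    have e : x = ∑ i, x i • EuclideanSpace.single i (1 : ℝ) := by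
      ext j
      simp [Finset.sum_apply, Pi.single_apply]
    calc ‖x‖ = ‖∑ i, x i • EuclideanSpace.single i (1 : ℝ)‖ := by rw [← e]
      _ ≤ ∑ i, |x i| := norm_sum_le_of_le _ fun i _ => by simp [norm_smul]
  obtain ⟨M, hM1, hM, hMN⟩ : ∃ M : ℝ, 1 ≤ M ∧ (∀ i, |x i| ≤ M) ∧ M ^ N ≤ 1 + ∑ i, |x i| ^ N := by
    have hs : ∀ i, |x i| ^ N ≤ ∑ i, |x i| ^ N := fun i =>
      Finset.single_le_sum (f := fun i => |x i| ^ N) (fun _ _ => by positivity) (Finset.mem_univ i)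
    by_cases hall : ∀ i, |x i| ≤ 1
    · exact ⟨1, le_rfl, hall, by
        rw [one_pow]; exact le_add_of_nonneg_right (Finset.sum_nonneg fun _ _ => by positivity)⟩
    · push Not at hall
      obtain ⟨j, hj⟩ := hall
      have : Nonempty (Fin n) := ⟨j⟩
      obtain ⟨i, hi⟩ := Finite.exists_max fun i => |x i|
      exact ⟨|x i|, hj.le.trans (hi j), hi, (hs i).trans (by linarith)⟩
  calc (1 + ‖x‖) ^ N ≤ (((n : ℝ) + 1) * M) ^ N := by
        gcongr
        calc 1 + ‖x‖ ≤ M + ∑ i : Fin n, M :=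
              add_le_add hM1 (hx.trans (Finset.sum_le_sum fun i _ => hM i))
          _ = _ := by simp; ring
    _ ≤ _ := by rw [mul_pow]; gcongr

/-! ### The estimates for the Fourier transformation -/

/-- The bound `|x^β D^α f(x)| ≤ K β! e^{-h(β)}` for all `x`, `β` and `|α| ≤ m`. -/
def GBound {n : ℕ} (h : Rn n → ℝ) (m : ℕ) (f : smoothFun n) (K : ℝ) : Prop :=
  ∀ α, multiOrder α ≤ m → ∀ β x,
    ‖(multiPow coordOp β (multiPow derivOp α f) : Rn n → ℂ) x‖ ≤ K * (multiFact β * expWeight h β)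

/-- The bound `(1 + ‖x‖)^m |D^β f(x)| ≤ K β! e^{-h(β)}` for all `x` and `β`. -/
def EBound {n : ℕ} (h : Rn n → ℝ) (m : ℕ) (f : smoothFun n) (K : ℝ) : Prop :=
  ∀ β x, (1 + ‖x‖) ^ m * ‖(multiPow derivOp β f : Rn n → ℂ) x‖ ≤ K * (multiFact β * expWeight h β)

theorem GBound.nonneg {n : ℕ} {h : Rn n → ℝ} {m : ℕ} {f : smoothFun n} {K : ℝ}
    (hf : GBound h m f K) :
    0 ≤ K :=
  nonneg_of_mul_nonneg_left ((norm_nonneg _).trans (hf 0 (by simp [multiOrder]) 0 0))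
    (mul_pos (multiFact_pos _) (expWeight_pos _ _))

theorem EBound.nonneg {n : ℕ} {h : Rn n → ℝ} {m : ℕ} {f : smoothFun n} {K : ℝ}
    (hf : EBound h m f K) :
    0 ≤ K :=
  nonneg_of_mul_nonneg_left (le_trans (by positivity) (hf 0 0))
    (mul_pos (multiFact_pos _) (expWeight_pos _ _))

/-- Bounds for `|x^β g(x)|` that are uniform in `β` contain bounds with polynomial weights, for the
next weight of the family. -/
theorem IsWeightFamily.exists_one_add_norm_pow_mul_le {n : ℕ} {h : ℕ → Rn n → ℝ}
    (hh : IsWeightFamily h) (ν N : ℕ) : ∃ C, 0 ≤ C ∧ ∀ (g : smoothFun n) (K : ℝ), 0 ≤ K →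
      (∀ β x, ‖(multiPow coordOp β g : Rn n → ℂ) x‖ ≤ K * (multiFact β * expWeight (h ν) β)) →
      ∀ β x, (1 + ‖x‖) ^ N * ‖(multiPow coordOp β g : Rn n → ℂ) x‖ ≤
        C * K * (multiFact β * expWeight (h (ν + 1)) β) := by
  obtain ⟨C₀, hC₀, h0⟩ := hh.shiftDominated ν 0
  obtain ⟨C₁, hC₁, h1⟩ := hh.multiFact_mul_expWeight_add_single_le ν N
  refine ⟨((n : ℝ) + 1) ^ N * (C₀ + n * C₁), by positivity, fun g K hK hg β x => ?_⟩
  have hβ := (multiFact_pos β).le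
  have e0 : ‖(multiPow coordOp β g : Rn n → ℂ) x‖ ≤
      C₀ * K * (multiFact β * expWeight (h (ν + 1)) β) :=
    calc _ ≤ K * (multiFact β * expWeight (h ν) β) := hg β x
      _ ≤ K * (multiFact β * (C₀ * expWeight (h (ν + 1)) β)) := by
          have := (h0 β).2
          rw [tsub_zero] at this
          gcongr
      _ = _ := by ring
  have e1 : ∀ i, |x i| ^ N * ‖(multiPow coordOp β g : Rn n → ℂ) x‖ ≤
      C₁ * K * (multiFact β * expWeight (h (ν + 1)) β) := by
    intro i
    have e := hg (β + Pi.single i N) x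
    rw [multiPow_add_single_pow _ coordOp_commute, Module.End.mul_apply, coordOp_pow_apply,
      norm_mul, norm_pow, Complex.norm_real, Real.norm_eq_abs] at e
    calc _ ≤ _ := e
      _ ≤ K * (C₁ * (multiFact β * expWeight (h (ν + 1)) β)) :=
          mul_le_mul_of_nonneg_left (h1 β i) hK
      _ = _ := by ring
  calc _ ≤ ((n : ℝ) + 1) ^ N * (1 + ∑ i, |x i| ^ N) * ‖(multiPow coordOp β g : Rn n → ℂ) x‖ := by
        gcongr
        exact one_add_norm_pow_le N x
    _ = ((n : ℝ) + 1) ^ N * (‖(multiPow coordOp β g : Rn n → ℂ) x‖ +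
        ∑ i, |x i| ^ N * ‖(multiPow coordOp β g : Rn n → ℂ) x‖) := by
        rw [← Finset.sum_mul]; ring
    _ ≤ ((n : ℝ) + 1) ^ N * (C₀ * K * (multiFact β * expWeight (h (ν + 1)) β) +
        ∑ i : Fin n, C₁ * K * (multiFact β * expWeight (h (ν + 1)) β)) := by
        exact mul_le_mul_of_nonneg_left (add_le_add e0 (Finset.sum_le_sum fun i _ => e1 i))
          (by positivity)
    _ = _ := by
        rw [Finset.sum_const, Finset.card_univ, Fintype.card_fin, nsmul_eq_mul]; ring

theorem multiPow_schwartzCoord_deriv_apply {n : ℕ} (α β : Fin n → ℕ) (φ : 𝓢(Rn n, ℂ)) (x : Rn n) :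
    multiPow schwartzCoord β (multiPow schwartzDeriv α φ) x =
      (multiPow coordOp β (multiPow derivOp α (schwartzInclusion n φ)) : Rn n → ℂ) x := by
  have e1 := map_multiPow _ _ _ _ schwartzInclusion_deriv α φ
  have e2 := map_multiPow _ _ _ _ schwartzInclusion_coord β (multiPow schwartzDeriv α φ)
  rw [one_pow, one_smul] at e1 e2
  rw [← e1, ← e2]
  rfl

theorem multiPow_schwartzDeriv_coord_apply {n : ℕ} (α β : Fin n → ℕ) (φ : 𝓢(Rn n, ℂ)) (x : Rn n) :
    multiPow schwartzDeriv β (multiPow schwartzCoord α φ) x =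
      (multiPow derivOp β (multiPow coordOp α (schwartzInclusion n φ)) : Rn n → ℂ) x := by
  have e1 := map_multiPow _ _ _ _ schwartzInclusion_coord α φ
  have e2 := map_multiPow _ _ _ _ schwartzInclusion_deriv β (multiPow schwartzCoord α φ)
  rw [one_pow, one_smul] at e1 e2
  rw [← e1, ← e2]
  rfl

/-- The Fourier transformation maps `G(h_ν)` to `E(h_{ν+2})`, with bounds. One step in the family
of weights pays for integrating over `ℝⁿ`, the other one for the Leibniz rule. -/
theorem IsWeightFamily.exists_eBound_schwartzFourier {n : ℕ} {h : ℕ → Rn n → ℝ}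
    (hh : IsWeightFamily h) (ν m : ℕ) : ∃ C, 0 ≤ C ∧ ∀ (φ : 𝓢(Rn n, ℂ)) (K : ℝ), 0 ≤ K →
      GBound (h ν) m (schwartzInclusion n φ) K →
      EBound (h (ν + 2)) m (schwartzInclusion n (schwartzFourier n φ)) (C * K) := by
  obtain ⟨N, A, hA, hfour⟩ := exists_norm_schwartzFourier_le n
  obtain ⟨B, hB, hdecay⟩ := hh.exists_one_add_norm_pow_mul_le ν N
  choose V hV hVb using fun i =>
    exists_norm_coord_deriv_le _ _ (hh.shiftDominated (ν + 1)) i m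
  choose D hD hVD using fun i => hV i 0
  obtain ⟨D₀, hD₀, hVD₀⟩ := hh.shiftDominated (ν + 1) 0
  refine ⟨((n : ℝ) + 1) ^ m * (D₀ + ∑ i, D i) * (A * B),
    mul_nonneg (mul_nonneg (by positivity) (add_nonneg hD₀ (Finset.sum_nonneg fun i _ => hD i)))
      (by positivity), fun φ K hK hφ β x => ?_⟩
  set u := schwartzInclusion n (schwartzFourier n φ) with hu
  have key : ∀ α, multiOrder α ≤ m → ∀ β x,
      ‖(multiPow derivOp β (multiPow coordOp α u) : Rn n → ℂ) x‖ ≤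
        A * B * K * (multiFact β * expWeight (h (ν + 1)) β) := by
    intro α hα β x
    rw [hu, norm_multiPow_schwartzFourier]
    refine ((hfour _ (B * K * (multiFact β * expWeight (h (ν + 1)) β)) (fun ξ => ?_) x).1).trans
      (le_of_eq (by ring))
    rw [multiPow_schwartzCoord_deriv_apply]
    exact hdecay _ K hK (hφ α hα) β ξ
  have hβ := (multiFact_pos β).le
  have e0 : ‖(multiPow derivOp β u : Rn n → ℂ) x‖ ≤
      D₀ * (A * B * K * (multiFact β * expWeight (h (ν + 2)) β)) :=
    calc _ ≤ A * B * K * (multiFact β * expWeight (h (ν + 1)) β) := by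
          have := key 0 (by simp [multiOrder]) β x
          rwa [multiPow_zero, Module.End.one_apply] at this
      _ ≤ A * B * K * (multiFact β * (D₀ * expWeight (h (ν + 2)) β)) := by
          have := (hVD₀ β).2
          rw [tsub_zero] at this
          gcongr
      _ = _ := by ring
  have e1 : ∀ i, |x i| ^ m * ‖(multiPow derivOp β u : Rn n → ℂ) x‖ ≤
      D i * (A * B * K * (multiFact β * expWeight (h (ν + 2)) β)) := by
    intro i
    calc _ ≤ A * B * K * (multiFact β * V i β) := by
          refine hVb i u (A * B * K) (by positivity) (fun j hj β x => ?_) β x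
          rw [← multiPow_single _ coordOp_commute]
          exact key _ (by simpa [multiOrder] using hj) β x
      _ ≤ A * B * K * (multiFact β * (D i * expWeight (h (ν + 2)) β)) := by
          have := (hVD i β).2
          rw [tsub_zero] at this
          gcongr
      _ = _ := by ring
  calc _ ≤ ((n : ℝ) + 1) ^ m * (1 + ∑ i, |x i| ^ m) * ‖(multiPow derivOp β u : Rn n → ℂ) x‖ := by
        gcongr
        exact one_add_norm_pow_le m x
    _ = ((n : ℝ) + 1) ^ m * (‖(multiPow derivOp β u : Rn n → ℂ) x‖ +
        ∑ i, |x i| ^ m * ‖(multiPow derivOp β u : Rn n → ℂ) x‖) := by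
        rw [← Finset.sum_mul]; ring
    _ ≤ ((n : ℝ) + 1) ^ m * (D₀ * (A * B * K * (multiFact β * expWeight (h (ν + 2)) β)) +
        ∑ i : Fin n, D i * (A * B * K * (multiFact β * expWeight (h (ν + 2)) β))) := by
        exact mul_le_mul_of_nonneg_left (add_le_add e0 (Finset.sum_le_sum fun i _ => e1 i))
          (by positivity)
    _ = _ := by rw [← Finset.sum_mul]; ring

/-- The inverse Fourier transformation maps `E(h_ν)` to `G(h_{ν+1})`, with bounds. -/
theorem IsWeightFamily.exists_gBound_schwartzFourier_symm {n : ℕ} {h : ℕ → Rn n → ℝ}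
    (hh : IsWeightFamily h) (ν m : ℕ) : ∃ (M : ℕ) (C : ℝ), 0 ≤ C ∧
      ∀ (φ : 𝓢(Rn n, ℂ)) (K : ℝ), 0 ≤ K → EBound (h ν) M (schwartzInclusion n φ) K →
        GBound (h (ν + 1)) m (schwartzInclusion n ((schwartzFourier n).symm φ)) (C * K) := by
  obtain ⟨N, A, hA, hfour⟩ := exists_norm_schwartzFourier_le n
  choose C hC hCb using fun α =>
    exists_norm_deriv_coord_le _ α _ (hh.shiftDominated ν)
  -- The constants for the finitely many `α` with `|α| ≤ m` are added up.
  refine ⟨N + m, A * ∑ α ∈ Finset.Iic (fun _ : Fin n => m), C α,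
    mul_nonneg hA (Finset.sum_nonneg fun α _ => hC α), fun φ K hK hφ α hα β x => ?_⟩
  have hmem : α ∈ Finset.Iic (fun _ : Fin n => m) := Finset.mem_Iic.2 fun i =>
    (Finset.single_le_sum (fun _ _ => Nat.zero_le _) (Finset.mem_univ i)).trans hα
  have hle : C α ≤ ∑ α ∈ Finset.Iic (fun _ : Fin n => m), C α :=
    Finset.single_le_sum (fun α _ => hC α) hmem
  rw [norm_multiPow_schwartzFourier_symm]
  refine ((hfour _ (C α * K * (multiFact β * expWeight (h (ν + 1)) β)) (fun ξ => ?_) x).2).trans ?_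
  · rw [multiPow_schwartzDeriv_coord_apply]
    refine hCb α N _ K hK (fun β x => le_trans ?_ (hφ β x)) β ξ
    gcongr
    simp
  · have h1 := (multiFact_pos β).le
    have h2 := (expWeight_pos (h (ν + 1)) β).le
    calc A * (C α * K * (multiFact β * expWeight (h (ν + 1)) β)) =
          A * C α * K * (multiFact β * expWeight (h (ν + 1)) β) := by ring
      _ ≤ _ := by gcongr

/-! ### The spaces `G(h)` and `E(h)` inside the Schwartz space -/

theorem gTerm_le_iff {n : ℕ} (h : Rn n → ℝ) (f : smoothFun n) (x : Rn n) (β α : Fin n → ℕ) (K : ℝ) :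
    gTerm h f x β α ≤ K ↔
      ‖(multiPow coordOp β (multiPow derivOp α f) : Rn n → ℂ) x‖ ≤
        K * (multiFact β * expWeight h β) := by
  rw [multiPow_coordOp_apply, coe_multiPow_derivOp]
  exact div_le_iff₀ (mul_pos (multiFact_pos β) (Real.exp_pos _))

theorem eTerm_le_iff {n : ℕ} (h : Rn n → ℝ) (m : ℕ) (f : smoothFun n) (x : Rn n) (β : Fin n → ℕ)
    (K : ℝ) : eTerm h m f x β ≤ K ↔
      (1 + ‖x‖) ^ m * ‖(multiPow derivOp β f : Rn n → ℂ) x‖ ≤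
        K * (multiFact β * expWeight h β) := by
  rw [coe_multiPow_derivOp]
  exact div_le_iff₀ (mul_pos (multiFact_pos β) (Real.exp_pos _))

theorem gBound_iff {n : ℕ} (h : Rn n → ℝ) (m : ℕ) (f : smoothFun n) (K : ℝ) :
    GBound h m f K ↔ ∀ p : GIndex n m, gTerm h f p.1 p.2.1 p.2.2 ≤ K :=
  ⟨fun hf p => (gTerm_le_iff h f p.1 p.2.1 p.2.2 K).2 (hf _ p.2.2.2 _ _),
    fun hf α hα β x => (gTerm_le_iff h f x β α K).1 (hf (x, β, ⟨α, hα⟩))⟩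

theorem eBound_iff {n : ℕ} (h : Rn n → ℝ) (m : ℕ) (f : smoothFun n) (K : ℝ) :
    EBound h m f K ↔ ∀ p : Rn n × (Fin n → ℕ), eTerm h m f p.1 p.2 ≤ K :=
  ⟨fun hf p => (eTerm_le_iff h m f p.1 p.2 K).2 (hf _ _),
    fun hf β x => (eTerm_le_iff h m f x β K).1 (hf (x, β))⟩

theorem GSub_le_smoothFun {n : ℕ} (h : Rn n → ℝ) : GSub h ≤ smoothFun n := fun _ hf =>
  contDiff_infty.2 fun m => ((Submodule.mem_iInf _).1 hf m).1

theorem ESub_le_smoothFun {n : ℕ} (h : Rn n → ℝ) : ESub h ≤ smoothFun n := fun _ hf =>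
  ((Submodule.mem_iInf _).1 hf 0).1

theorem mem_GSub_iff {n : ℕ} (h : Rn n → ℝ) (f : smoothFun n) :
    (f : Rn n → ℂ) ∈ GSub h ↔ ∀ m, ∃ K, GBound h m f K := by
  refine (Submodule.mem_iInf _).trans (forall_congr' fun m => ?_)
  constructor
  · rintro ⟨-, K, hK⟩
    exact ⟨K, (gBound_iff h m f K).2 fun p => hK ⟨p, rfl⟩⟩
  · rintro ⟨K, hK⟩
    refine ⟨(smoothFun.contDiff f).of_le (by exact_mod_cast le_top), K, ?_⟩
    rintro _ ⟨p, rfl⟩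
    exact (gBound_iff h m f K).1 hK p

theorem mem_ESub_iff {n : ℕ} (h : Rn n → ℝ) (f : smoothFun n) :
    (f : Rn n → ℂ) ∈ ESub h ↔ ∀ m, ∃ K, EBound h m f K := by
  refine (Submodule.mem_iInf _).trans (forall_congr' fun m => ?_)
  constructor
  · rintro ⟨-, K, hK⟩
    exact ⟨K, (eBound_iff h m f K).2 fun p => hK ⟨p, rfl⟩⟩
  · rintro ⟨K, hK⟩
    refine ⟨smoothFun.contDiff f, K, ?_⟩
    rintro _ ⟨p, rfl⟩
    exact (eBound_iff h m f K).1 hK p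

theorem gBound_gSeminorm {n : ℕ} {h : Rn n → ℝ} (m : ℕ) (f : smoothFun n) (g : GSpace h)
    (hg : g.1 = f) : GBound h m f (gSeminorm h m g) := by
  rw [gBound_iff, ← hg]
  exact fun p => le_ciSup ((Submodule.mem_iInf _).1 g.2 m).2 p

theorem gSeminorm_le {n : ℕ} {h : Rn n → ℝ} {m : ℕ} {f : smoothFun n} {g : GSpace h}
    (hg : g.1 = f) {K : ℝ} (hf : GBound h m f K) : gSeminorm h m g ≤ K := by
  rw [gBound_iff, ← hg] at hf
  exact ciSup_le hf

theorem eBound_eSeminorm {n : ℕ} {h : Rn n → ℝ} (m : ℕ) (f : smoothFun n) (g : ESpace h)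
    (hg : g.1 = f) : EBound h m f (eSeminorm h m g) := by
  rw [eBound_iff, ← hg]
  exact fun p => le_ciSup ((Submodule.mem_iInf _).1 g.2 m).2 p

theorem eSeminorm_le {n : ℕ} {h : Rn n → ℝ} {m : ℕ} {f : smoothFun n} {g : ESpace h}
    (hg : g.1 = f) {K : ℝ} (hf : EBound h m f K) : eSeminorm h m g ≤ K := by
  rw [eBound_iff, ← hg] at hf
  exact ciSup_le hf

/-- The Schwartz functions, as a space of functions on `ℝⁿ`. -/
noncomputable def schwartzCoe (n : ℕ) : 𝓢(Rn n, ℂ) →ₗ[ℂ] Rn n → ℂ :=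
  (smoothFun n).subtype ∘ₗ schwartzInclusion n

theorem schwartzCoe_injective (n : ℕ) : Function.Injective (schwartzCoe n) :=
  fun _ _ hφ => DFunLike.coe_injective hφ

theorem IsWeightFamily.GSub_le_range {n : ℕ} {h : ℕ → Rn n → ℝ} (hh : IsWeightFamily h) (ν : ℕ) :
    GSub (h ν) ≤ LinearMap.range (schwartzCoe n) := by
  intro f hf
  let g : smoothFun n := ⟨f, GSub_le_smoothFun _ hf⟩
  suffices hg : RapidlyDecreasing g from ⟨hg.toSchwartz, rfl⟩
  intro α k
  obtain ⟨K, hK⟩ := (mem_GSub_iff (h ν) g).1 hf (multiOrder α)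
  obtain ⟨C, -, hC⟩ := hh.exists_one_add_norm_pow_mul_le ν k
  refine ⟨_, fun x => le_trans ?_ (hC (multiPow derivOp α g) K hK.nonneg (hK α le_rfl) 0 x)⟩
  rw [multiPow_zero, Module.End.one_apply]
  gcongr
  simp

theorem ESub_le_range {n : ℕ} (h : Rn n → ℝ) : ESub h ≤ LinearMap.range (schwartzCoe n) := by
  intro f hf
  let g : smoothFun n := ⟨f, ESub_le_smoothFun _ hf⟩
  suffices hg : RapidlyDecreasing g from ⟨hg.toSchwartz, rfl⟩
  intro α k
  obtain ⟨K, hK⟩ := (mem_ESub_iff h g).1 hf k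
  refine ⟨_, fun x => le_trans ?_ (hK α x)⟩
  gcongr
  simp

/-- The map that a linear map `T` of the Schwartz space induces between subspaces of it, these being
seen as spaces of functions. -/
noncomputable def schwartzRestrict {n : ℕ} (T : 𝓢(Rn n, ℂ) →ₗ[ℂ] 𝓢(Rn n, ℂ))
    {V V' : Submodule ℂ (Rn n → ℂ)} (hV : V ≤ LinearMap.range (schwartzCoe n))
    (hT : ∀ φ, schwartzCoe n φ ∈ V → schwartzCoe n (T φ) ∈ V') : V →ₗ[ℂ] V' :=
  (schwartzCoe n ∘ₗ T ∘ₗ (LinearEquiv.ofInjective _ (schwartzCoe_injective n)).symm.toLinearMap ∘ₗ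
    Submodule.inclusion hV).codRestrict V' fun v => hT _ <| by
      have := congrArg Subtype.val ((LinearEquiv.ofInjective _
        (schwartzCoe_injective n)).apply_symm_apply (Submodule.inclusion hV v))
      exact (this.symm ▸ v.2 : _)

theorem schwartzRestrict_apply {n : ℕ} (T : 𝓢(Rn n, ℂ) →ₗ[ℂ] 𝓢(Rn n, ℂ))
    {V V' : Submodule ℂ (Rn n → ℂ)} (hV : V ≤ LinearMap.range (schwartzCoe n))
    (hT : ∀ φ, schwartzCoe n φ ∈ V → schwartzCoe n (T φ) ∈ V') (v : V) (φ : 𝓢(Rn n, ℂ))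
    (hφ : schwartzCoe n φ = v) : (schwartzRestrict T hV hT v : Rn n → ℂ) = schwartzCoe n (T φ) := by
  have e : (LinearEquiv.ofInjective _ (schwartzCoe_injective n)).symm
      (Submodule.inclusion hV v) = φ :=
    (LinearEquiv.symm_apply_eq _).2 (Subtype.ext hφ.symm)
  exact congrArg (fun ψ => schwartzCoe n (T ψ)) e

/-! ### Locally convex inductive limits -/

section InductiveLimit

variable {ι : Type} {W : ι → Type} [∀ i, TopologicalSpace (W i)] {V : Type} [AddCommGroup V]
  [Module ℂ V] (j : ∀ i, W i → V)

theorem continuous_inductiveLimit (i : ι) : @Continuous _ _ _ (inductiveLimitTopology j) (j i) :=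
  continuous_sInf_rng.2 fun _ ht => ht.1 i

theorem isTopologicalAddGroup_inductiveLimit :
    @IsTopologicalAddGroup V (inductiveLimitTopology j) _ :=
  topologicalAddGroup_sInf fun _ ht => ht.2.1

theorem continuousSMul_inductiveLimit :
    @ContinuousSMul ℂ V _ _ (inductiveLimitTopology j) :=
  continuousSMul_sInf fun _ ht => ht.2.2.1

theorem locallyConvexSpace_inductiveLimit :
    @LocallyConvexSpace ℝ V _ _ _ _ (inductiveLimitTopology j) :=
  LocallyConvexSpace.sInf fun _ ht => ht.2.2.2

/-- A linear map out of a locally convex inductive limit is continuous if its restrictions to all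
the steps are. -/
theorem continuous_of_inductiveLimit {V' : Type} [AddCommGroup V'] [Module ℂ V']
    [t : TopologicalSpace V'] [IsTopologicalAddGroup V'] [ContinuousSMul ℂ V']
    [LocallyConvexSpace ℝ V'] (T : V →ₗ[ℂ] V') (hT : ∀ i, Continuous fun w => T (j i w)) :
    @Continuous V V' (inductiveLimitTopology j) t T := by
  refine continuous_iff_le_induced.2 (sInf_le
    ⟨fun i => continuous_induced_rng.2 (hT i), ?_, ?_, ?_⟩)
  · exact topologicalAddGroup_induced T
  · exact ContinuousSMul.induced T
  · exact LocallyConvexSpace.induced (T.restrictScalars ℝ)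

end InductiveLimit

section Limits

variable {n : ℕ} {h : ℕ → Rn n → ℝ} (hh : IsWeightFamily h)

instance : IsTopologicalAddGroup (GLimit hh) := isTopologicalAddGroup_inductiveLimit _

instance : ContinuousSMul ℂ (GLimit hh) := continuousSMul_inductiveLimit _

instance : LocallyConvexSpace ℝ (GLimit hh) := locallyConvexSpace_inductiveLimit _

instance : IsTopologicalAddGroup (ELimit hh) := isTopologicalAddGroup_inductiveLimit _

instance : ContinuousSMul ℂ (ELimit hh) := continuousSMul_inductiveLimit _

instance : LocallyConvexSpace ℝ (ELimit hh) := locallyConvexSpace_inductiveLimit _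

end Limits

theorem withSeminorms_GSpace {n : ℕ} (h : Rn n → ℝ) : WithSeminorms (gSeminorm h) := ⟨rfl⟩

theorem withSeminorms_ESpace {n : ℕ} (h : Rn n → ℝ) : WithSeminorms (eSeminorm h) := ⟨rfl⟩

/-! ### The Fourier transformation between the inductive limits -/

namespace IsWeightFamily

variable {n : ℕ} {h : ℕ → Rn n → ℝ}

theorem GUnion_le_range (hh : IsWeightFamily h) :
    GUnion hh ≤ LinearMap.range (schwartzCoe n) := fun f hf => by
  obtain ⟨ν, hν⟩ := mem_iUnion.1 hf
  exact hh.GSub_le_range ν hν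

theorem EUnion_le_range (hh : IsWeightFamily h) :
    EUnion hh ≤ LinearMap.range (schwartzCoe n) := fun f hf => by
  obtain ⟨ν, hν⟩ := mem_iUnion.1 hf
  exact ESub_le_range (h ν) hν

theorem schwartzFourier_mem_ESub (hh : IsWeightFamily h) (ν : ℕ) (φ : 𝓢(Rn n, ℂ))
    (hφ : schwartzCoe n φ ∈ GSub (h ν)) :
    schwartzCoe n (schwartzFourier n φ) ∈ ESub (h (ν + 2)) := by
  refine (mem_ESub_iff _ (schwartzInclusion n (schwartzFourier n φ))).2 fun m => ?_
  obtain ⟨C, -, hC⟩ := hh.exists_eBound_schwartzFourier ν m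
  obtain ⟨K, hK⟩ := (mem_GSub_iff _ (schwartzInclusion n φ)).1 hφ m
  exact ⟨C * K, hC φ K hK.nonneg hK⟩

theorem schwartzFourier_symm_mem_GSub (hh : IsWeightFamily h) (ν : ℕ) (φ : 𝓢(Rn n, ℂ))
    (hφ : schwartzCoe n φ ∈ ESub (h ν)) :
    schwartzCoe n ((schwartzFourier n).symm φ) ∈ GSub (h (ν + 1)) := by
  refine (mem_GSub_iff _ (schwartzInclusion n ((schwartzFourier n).symm φ))).2 fun m => ?_
  obtain ⟨M, C, -, hC⟩ := hh.exists_gBound_schwartzFourier_symm ν m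
  obtain ⟨K, hK⟩ := (mem_ESub_iff _ (schwartzInclusion n φ)).1 hφ M
  exact ⟨C * K, hC φ K hK.nonneg hK⟩

theorem schwartzFourier_mem_EUnion (hh : IsWeightFamily h) (φ : 𝓢(Rn n, ℂ))
    (hφ : schwartzCoe n φ ∈ GUnion hh) :
    schwartzCoe n (schwartzFourier n φ) ∈ EUnion hh := by
  obtain ⟨ν, hν⟩ := mem_iUnion.1 hφ
  exact mem_iUnion.2 ⟨ν + 2, hh.schwartzFourier_mem_ESub ν φ hν⟩

theorem schwartzFourier_symm_mem_GUnion (hh : IsWeightFamily h) (φ : 𝓢(Rn n, ℂ))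
    (hφ : schwartzCoe n φ ∈ EUnion hh) :
    schwartzCoe n ((schwartzFourier n).symm φ) ∈ GUnion hh := by
  obtain ⟨ν, hν⟩ := mem_iUnion.1 hφ
  exact mem_iUnion.2 ⟨ν + 1, hh.schwartzFourier_symm_mem_GSub ν φ hν⟩

/-- The Fourier transformation `G(h_ν) → E(h_{ν+2})`. -/
noncomputable def fourierStep (hh : IsWeightFamily h) (ν : ℕ) :
    GSpace (h ν) →ₗ[ℂ] ESpace (h (ν + 2)) :=
  schwartzRestrict (V := GSub (h ν)) (V' := ESub (h (ν + 2))) (schwartzFourier n).toLinearMap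
    (hh.GSub_le_range ν) (hh.schwartzFourier_mem_ESub ν)

/-- The inverse Fourier transformation `E(h_ν) → G(h_{ν+1})`. -/
noncomputable def fourierInvStep (hh : IsWeightFamily h) (ν : ℕ) :
    ESpace (h ν) →ₗ[ℂ] GSpace (h (ν + 1)) :=
  schwartzRestrict (V := ESub (h ν)) (V' := GSub (h (ν + 1))) (schwartzFourier n).symm.toLinearMap
    (ESub_le_range (h ν)) (hh.schwartzFourier_symm_mem_GSub ν)

/-- The Fourier transformation `G(H) → E(H)`. -/
noncomputable def fourierLimit (hh : IsWeightFamily h) : GLimit hh →ₗ[ℂ] ELimit hh :=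
  schwartzRestrict (V := GUnion hh) (V' := EUnion hh) (schwartzFourier n).toLinearMap
    hh.GUnion_le_range hh.schwartzFourier_mem_EUnion

/-- The inverse Fourier transformation `E(H) → G(H)`. -/
noncomputable def fourierInvLimit (hh : IsWeightFamily h) : ELimit hh →ₗ[ℂ] GLimit hh :=
  schwartzRestrict (V := EUnion hh) (V' := GUnion hh) (schwartzFourier n).symm.toLinearMap
    hh.EUnion_le_range hh.schwartzFourier_symm_mem_GUnion

theorem coe_fourierStep (hh : IsWeightFamily h) (ν : ℕ) (f : GSpace (h ν)) (φ : 𝓢(Rn n, ℂ))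
    (hφ : schwartzCoe n φ = f.1) :
    (hh.fourierStep ν f).1 = schwartzCoe n (schwartzFourier n φ) :=
  schwartzRestrict_apply (V := GSub (h ν)) (V' := ESub (h (ν + 2))) _ _ _ _ φ hφ

theorem coe_fourierInvStep (hh : IsWeightFamily h) (ν : ℕ) (f : ESpace (h ν)) (φ : 𝓢(Rn n, ℂ))
    (hφ : schwartzCoe n φ = f.1) :
    (hh.fourierInvStep ν f).1 = schwartzCoe n ((schwartzFourier n).symm φ) :=
  schwartzRestrict_apply (V := ESub (h ν)) (V' := GSub (h (ν + 1))) _ _ _ _ φ hφ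

theorem coe_fourierLimit (hh : IsWeightFamily h) (f : GLimit hh) (φ : 𝓢(Rn n, ℂ))
    (hφ : schwartzCoe n φ = f.1) :
    (hh.fourierLimit f).1 = schwartzCoe n (schwartzFourier n φ) :=
  schwartzRestrict_apply (V := GUnion hh) (V' := EUnion hh) _ _ _ _ φ hφ

theorem coe_fourierInvLimit (hh : IsWeightFamily h) (f : ELimit hh) (φ : 𝓢(Rn n, ℂ))
    (hφ : schwartzCoe n φ = f.1) :
    (hh.fourierInvLimit f).1 = schwartzCoe n ((schwartzFourier n).symm φ) :=
  schwartzRestrict_apply (V := EUnion hh) (V' := GUnion hh) _ _ _ _ φ hφ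

theorem continuous_fourierStep (hh : IsWeightFamily h) (ν : ℕ) :
    Continuous (hh.fourierStep ν) := by
  refine WithSeminorms.continuous_of_isBounded (withSeminorms_GSpace _) (withSeminorms_ESpace _) _
    fun m => ?_
  obtain ⟨C, hC0, hC⟩ := hh.exists_eBound_schwartzFourier ν m
  refine ⟨{m}, ⟨C, hC0⟩, fun f => ?_⟩
  obtain ⟨φ, hφ⟩ := hh.GSub_le_range ν f.2
  rw [Finset.sup_singleton]
  exact eSeminorm_le (f := schwartzInclusion n (schwartzFourier n φ)) (hh.coe_fourierStep ν f φ hφ)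
    (hC φ _ (apply_nonneg _ _) (gBound_gSeminorm m (schwartzInclusion n φ) f hφ.symm))

theorem continuous_fourierInvStep (hh : IsWeightFamily h) (ν : ℕ) :
    Continuous (hh.fourierInvStep ν) := by
  refine WithSeminorms.continuous_of_isBounded (withSeminorms_ESpace _) (withSeminorms_GSpace _) _
    fun m => ?_
  obtain ⟨M, C, hC0, hC⟩ := hh.exists_gBound_schwartzFourier_symm ν m
  refine ⟨{M}, ⟨C, hC0⟩, fun f => ?_⟩
  obtain ⟨φ, hφ⟩ := ESub_le_range (h ν) f.2
  rw [Finset.sup_singleton]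
  exact gSeminorm_le (f := schwartzInclusion n ((schwartzFourier n).symm φ))
    (hh.coe_fourierInvStep ν f φ hφ)
    (hC φ _ (apply_nonneg _ _) (eBound_eSeminorm M (schwartzInclusion n φ) f hφ.symm))

theorem continuous_fourierLimit (hh : IsWeightFamily h) : Continuous hh.fourierLimit := by
  refine continuous_of_inductiveLimit (gInclusion hh) hh.fourierLimit fun ν => ?_
  have e : (fun f => hh.fourierLimit (gInclusion hh ν f)) =
      fun f => eInclusion hh (ν + 2) (hh.fourierStep ν f) := funext fun f => by
    obtain ⟨φ, hφ⟩ := hh.GSub_le_range ν f.2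
    exact Subtype.ext ((hh.coe_fourierLimit _ φ hφ).trans (hh.coe_fourierStep ν f φ hφ).symm)
  rw [e]
  exact (continuous_inductiveLimit (eInclusion hh) (ν + 2)).comp (hh.continuous_fourierStep ν)

theorem continuous_fourierInvLimit (hh : IsWeightFamily h) : Continuous hh.fourierInvLimit := by
  refine continuous_of_inductiveLimit (eInclusion hh) hh.fourierInvLimit fun ν => ?_
  have e : (fun f => hh.fourierInvLimit (eInclusion hh ν f)) =
      fun f => gInclusion hh (ν + 1) (hh.fourierInvStep ν f) := funext fun f => by
    obtain ⟨φ, hφ⟩ := ESub_le_range (h ν) f.2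
    exact Subtype.ext ((hh.coe_fourierInvLimit _ φ hφ).trans (hh.coe_fourierInvStep ν f φ hφ).symm)
  rw [e]
  exact (continuous_inductiveLimit (gInclusion hh) (ν + 1)).comp (hh.continuous_fourierInvStep ν)

/-- The Fourier transformation as an isomorphism of topological vector spaces `G(H) ≅ E(H)`. -/
noncomputable def fourierEquivLimit (hh : IsWeightFamily h) : GLimit hh ≃L[ℂ] ELimit hh where
  __ := hh.fourierLimit
  invFun := hh.fourierInvLimit
  left_inv f := by
    obtain ⟨φ, hφ⟩ := hh.GUnion_le_range f.2
    refine Subtype.ext ((hh.coe_fourierInvLimit _ _ (hh.coe_fourierLimit f φ hφ).symm).trans ?_)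
    rw [LinearEquiv.symm_apply_apply, hφ]
  right_inv f := by
    obtain ⟨φ, hφ⟩ := hh.EUnion_le_range f.2
    refine Subtype.ext ((hh.coe_fourierLimit _ _ (hh.coe_fourierInvLimit f φ hφ).symm).trans ?_)
    rw [LinearEquiv.apply_symm_apply, hφ]
  continuous_toFun := hh.continuous_fourierLimit
  continuous_invFun := hh.continuous_fourierInvLimit

end IsWeightFamily

theorem theorem3 (n : ℕ) (h : ℕ → Rn n → ℝ) (hh : IsWeightFamily h) :
    (∀ f : GLimit hh, Integrable (f : Rn n → ℂ)) ∧
    ∃ F : GLimit hh ≃L[ℂ] ELimit hh,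
      ∀ (f : GLimit hh) (x : Rn n), (F f : Rn n → ℂ) x = fourierTr (f : Rn n → ℂ) x := by
  refine ⟨fun f => ?_, hh.fourierEquivLimit, fun f x => ?_⟩
  · obtain ⟨φ, hφ⟩ := hh.GUnion_le_range f.2
    rw [← hφ]
    exact φ.integrable
  · obtain ⟨φ, hφ⟩ := hh.GUnion_le_range f.2
    refine (congrFun (hh.coe_fourierLimit f φ hφ) x).trans ((schwartzFourier_apply φ x).trans ?_)
    rw [← hφ]
    rfl
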